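/- Let $d\ge 1$ and let $\Omega\subset\mathbb{R}^d$ be a bounded open set with $\Omega=\operatorname{int}\overline{\Omega}$, with a mesh $\Omega_h$: a finite set of pairwise disjoint polytopal cells $\Omega^e$ such that $\overline\Omega=\bigcup_e\overline{\Omega^e}$. Here a polytopal cell is a nonempty bounded open set, equal to the interior of its closure, whose boundary lies in finitely many hyperplanes (intervals for $d=1$, arbitrary, not necessarily convex, polygons and polyhedra for $d=2,3$). Let $\Gamma_s=\Omega\cap\bigcup_e\partial\Omega^e$ be the mesh skeleton, let $\Gamma_D\subset\partial\Omega$ be measurable, and let $\bar u\in L^2(\Gamma_D)$, where boundary and skeleton carry the $(d-1)$-dimensional surface measure $dS$. Let $$V=\{w\in L^2(\Omega):\ w|_{\Omega^e}\in H^1(\Omega^e)\ \text{for all }\Omega^e\in\Omega_h\}$$ be the broken Sobolev space. For $w\in V$ let $$[\![w]\!](x)=\lim_{\epsilon\to0^+}\bigl(w(x+\epsilon n)-w(x-\epsilon n)\bigr)$$ be the jump at almost every $x\in\Gamma_s$, where $n$ is a unit normal to $\Gamma_s$ at $x$, and let $w(x)=\lim_{\epsilon\to0^+}w(x-\epsilon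 n)$ be the trace at almost every $x\in\Gamma_D$, where $n$ is the outward unit normal of $\Omega$ (both limits are essential limits, i.e. they disregard null sets of $\epsilon$). Let $$V^c_b=\{w\in V:\ [\![w]\!]=0 \text{ a.e. on }\Gamma_s,\ w=\bar u\text{ a.e. on }\Gamma_D\},$$ and for $w,v\in V$ put $$d(w,v)=\int_{\Gamma_s}[\![w]\!]\,[\![v]\!]\,dS+\int_{\Gamma_D}w\,v\,dS,\qquad b(v)=\int_{\Gamma_D}\bar u\,v\,dS .$$ Let $D$ map $w\in V$ to the functional $Dw=d(w,\cdot)$ on $V$. Then for every $w\in V$, $$w\in V^c_b\iff Dw=b ,$$ that is, $w\in V^c_b$ if and only if $d(w,v)=b(v)$ for all $v\in V$. -/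

import Mathlib

open MeasureTheory Filter Topology
open scoped ContDiff

noncomputable section

namespace BrokenSobolev

/-- A polytopal cell in `ℝ^d` (an interval if `d = 1`, a polygon if `d = 2`, a polyhedron if
`d = 3`; convex or not): a nonempty bounded open set which has no slits (it is the interior of its
closure) and whose boundary lies in finitely many hyperplanes `{x | ⟪a, x⟫ = c}`, `a ≠ 0`. -/
structure IsPolytopalCell {d : ℕ} (K : Set (EuclideanSpace ℝ (Fin d))) : Prop where
  isOpen : IsOpen K
  nonempty : K.Nonempty
  isBounded : Bornology.IsBounded K
  interior_closure : interior (closure K) = K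
  frontier_subset : ∃ H : Finset (EuclideanSpace ℝ (Fin d) × ℝ), (∀ h ∈ H, h.1 ≠ 0) ∧
    frontier K ⊆ ⋃ h ∈ H, {x | inner ℝ h.1 x = h.2}

/-- A mesh `Ω_h` of `Ω`: finitely many pairwise disjoint polytopal cells that cover `Ω`. -/
structure Mesh {d : ℕ} (Ω : Set (EuclideanSpace ℝ (Fin d))) where
  /-- the cells `Ω^e` of the mesh -/
  cells : Finset (Set (EuclideanSpace ℝ (Fin d)))
  isPolytopalCell : ∀ K ∈ cells, IsPolytopalCell K
  disjoint : ∀ K ∈ cells, ∀ L ∈ cells, K ≠ L → Disjoint K L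
  cover : closure Ω = ⋃ K ∈ cells, closure K

/-- `G` is the weak gradient of `w` on the open set `K`. -/
def HasWeakGradient {d : ℕ} (K : Set (EuclideanSpace ℝ (Fin d)))
    (w : EuclideanSpace ℝ (Fin d) → ℝ)
    (G : EuclideanSpace ℝ (Fin d) → EuclideanSpace ℝ (Fin d)) : Prop :=
  ∀ φ : EuclideanSpace ℝ (Fin d) → ℝ, ContDiff ℝ ∞ φ → HasCompactSupport φ → tsupport φ ⊆ K →
    ∀ i : Fin d, ∫ x in K, w x * fderiv ℝ φ x (EuclideanSpace.single i 1)
      = - ∫ x in K, G x i * φ x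

/-- `w ∈ H¹(K)`. -/
def MemH1 {d : ℕ} (K : Set (EuclideanSpace ℝ (Fin d)))
    (w : EuclideanSpace ℝ (Fin d) → ℝ) : Prop :=
  MemLp w 2 (volume.restrict K) ∧
    ∃ G : EuclideanSpace ℝ (Fin d) → EuclideanSpace ℝ (Fin d),
      MemLp G 2 (volume.restrict K) ∧ HasWeakGradient K w G

/-- `n` is the outward unit normal of `K` at `x`: near `x`, the set `K` is exactly the open
half-space `{y | ⟪n, y - x⟫ < 0}`. For a polytopal cell such an `n` exists, and is unique, at all
boundary points off a set of vanishing `(d-1)`-dimensional measure (corners and edges). -/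
def IsOutwardNormal {d : ℕ} (K : Set (EuclideanSpace ℝ (Fin d)))
    (x n : EuclideanSpace ℝ (Fin d)) : Prop :=
  ‖n‖ = 1 ∧ ∃ r > 0, ∀ y ∈ Metric.ball x r, (y ∈ K ↔ inner ℝ n (y - x) < 0)

open Classical in
/-- The outward unit normal of `Ω` at `x` (the value `0` is used where there is none). -/
def outwardNormal {d : ℕ} (Ω : Set (EuclideanSpace ℝ (Fin d)))
    (x : EuclideanSpace ℝ (Fin d)) : EuclideanSpace ℝ (Fin d) :=
  if h : ∃ n, IsOutwardNormal Ω x n then h.choose else 0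

/-- The surface measure `dS` on subsets of `ℝ^d`: the `(d-1)`-dimensional Hausdorff measure,
normalized so that it is Lebesgue measure on hyperplanes (counting measure if `d = 1`). -/
def surfaceMeasure (d : ℕ) : Measure (EuclideanSpace ℝ (Fin d)) :=
  Measure.euclideanHausdorffMeasure (d - 1)

/-- The filter of the one-sided essential limit `ε → 0+`: limits along it disregard Lebesgue-null
sets of parameters `ε`. Limits of an `H¹` function along normals have to be taken in this sense to
be independent, at almost every boundary point, of the representative of the function. They exist
at almost every boundary point, where they give the Sobolev trace. -/
def essZeroRight : Filter ℝ := 𝓝[>] (0 : ℝ) ⊓ ae volume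

/-- The trace of `w` on the boundary of `Ω`, from inside `Ω`:
`lim_{ε → 0+} w (x - ε n)` with the outward unit normal `n`. -/
def boundaryTrace {d : ℕ} (Ω : Set (EuclideanSpace ℝ (Fin d)))
    (w : EuclideanSpace ℝ (Fin d) → ℝ) (x : EuclideanSpace ℝ (Fin d)) : ℝ :=
  limUnder essZeroRight fun ε : ℝ => w (x - ε • outwardNormal Ω x)

namespace Mesh

variable {d : ℕ} {Ω : Set (EuclideanSpace ℝ (Fin d))} (M : Mesh Ω)

/-- The mesh skeleton `Γ_s`: the part of the cell boundaries inside `Ω`. -/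
def skeleton : Set (EuclideanSpace ℝ (Fin d)) :=
  Ω ∩ ⋃ K ∈ M.cells, frontier K

open Classical in
/-- A unit normal to the skeleton at `x`: the outward one of either of the two cells that meet at
`x` (the value `0` is used where there is none). The choice of the side is immaterial, since
reversing it changes the sign of all jumps at `x`. -/
def skeletonNormal (x : EuclideanSpace ℝ (Fin d)) : EuclideanSpace ℝ (Fin d) :=
  if h : ∃ n, ∃ K ∈ M.cells, IsOutwardNormal K x n then h.choose else 0

/-- The difference `w (x + ε n) - w (x - ε n)` across the skeleton at `x`. -/
def normalDifference (w : EuclideanSpace ℝ (Fin d) → ℝ) (x : EuclideanSpace ℝ (Fin d))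
    (ε : ℝ) : ℝ :=
  w (x + ε • M.skeletonNormal x) - w (x - ε • M.skeletonNormal x)

/-- The jump `⟦w⟧ (x) = lim_{ε → 0+} (w (x + ε n) - w (x - ε n))`. -/
def jump (w : EuclideanSpace ℝ (Fin d) → ℝ) (x : EuclideanSpace ℝ (Fin d)) : ℝ :=
  limUnder essZeroRight (M.normalDifference w x)

/-- The broken Sobolev space `V`: functions in `L²(Ω)` that are in `H¹` of every cell. -/
def space : Set (EuclideanSpace ℝ (Fin d) → ℝ) :=
  {w | MemLp w 2 (volume.restrict Ω) ∧ ∀ K ∈ M.cells, MemH1 K w}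

/-- The admissible set `V^c_b`: the `w ∈ V` with `⟦w⟧ = 0` a.e. on `Γ_s` and `w = ū` a.e. on
`Γ_D`; the existence of the limits that define jump and trace is part of the condition. -/
def admissible (ΓD : Set (EuclideanSpace ℝ (Fin d))) (ubar : EuclideanSpace ℝ (Fin d) → ℝ) :
    Set (EuclideanSpace ℝ (Fin d) → ℝ) :=
  {w | w ∈ M.space ∧
    (∀ᵐ x ∂(surfaceMeasure d).restrict M.skeleton,
      Tendsto (M.normalDifference w x) essZeroRight (𝓝 0)) ∧
    (∀ᵐ x ∂(surfaceMeasure d).restrict ΓD,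
      Tendsto (fun ε : ℝ => w (x - ε • outwardNormal Ω x)) essZeroRight (𝓝 (ubar x)))}

/-- The form `d(w, v) = ⟨⟦w⟧, ⟦v⟧⟩_{Γ_s} + ⟨w, v⟩_{Γ_D}`. -/
def constraintForm (ΓD : Set (EuclideanSpace ℝ (Fin d)))
    (w v : EuclideanSpace ℝ (Fin d) → ℝ) : ℝ :=
  (∫ x in M.skeleton, M.jump w x * M.jump v x ∂surfaceMeasure d) +
    ∫ x in ΓD, boundaryTrace Ω w x * boundaryTrace Ω v x ∂surfaceMeasure d

/-- The operator `D`: it sends `w ∈ V` to the functional `v ↦ d(w, v)` on `V`. -/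
def constraintOperator (ΓD : Set (EuclideanSpace ℝ (Fin d))) (w : M.space) : M.space → ℝ :=
  fun v => M.constraintForm ΓD w v

/-- The functional `b` on `V`, `b(v) = ⟨ū, v⟩_{Γ_D}`. -/
def dirichletFunctional (ΓD : Set (EuclideanSpace ℝ (Fin d)))
    (ubar : EuclideanSpace ℝ (Fin d) → ℝ) : M.space → ℝ :=
  fun v => ∫ x in ΓD, ubar x * boundaryTrace Ω v x ∂surfaceMeasure d

end Mesh

end BrokenSobolev

end

/-! If the jump of `w` vanishes and its trace is `ubar` almost everywhere, the integrands of `d(w,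
v)` and `b(v)` agree almost everywhere, which settles one direction without any integrability.

The converse is local. Off a surface-null set, the cell boundaries near a point lie in one
hyperplane (`exists_null_forall_flat`), with one cell on each side if the point is on the skeleton
(`Mesh.exists_two_sides`), and with one cell inside and nothing of `Ω` outside if it is on the
boundary (`Mesh.exists_inner_side`). On such a flat piece `w` has integrable one-sided traces,
attained as essential limits along normals (`MemH1.exists_trace`). This follows from the fundamental
theorem of calculus on almost every normal line.

The test functions are `v = K.indicator φ` with `K` one adjacent cell and `φ` a bump supported near
the point. Then `v` has jump `±φ`, or trace `φ`, and `Dw = b` becomes `∫ (b - a) φ = 0` on the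
skeleton, or `∫ (a - ubar) φ = 0` on `ΓD`, with `a`, `b` the local traces of `w`. The two terms of
the form decouple because the small ball meets only one of the skeleton and `ΓD`. As `φ` is
arbitrary, the jump vanishes or the trace equals `ubar` almost everywhere near the point. -/

namespace BrokenSobolev

/-! ### Weak directional derivatives and translations -/

section Translation

variable {E : Type*} [NormedAddCommGroup E] [NormedSpace ℝ E]
  [MeasurableSpace E] [BorelSpace E] {μ : Measure E}

theorem hasDerivAt_integral_mul_translate {u φ : E → ℝ} (hu : Integrable u μ)
    (hφ : ContDiff ℝ ∞ φ) (hc : HasCompactSupport φ) (e : E) (σ : ℝ) :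
    HasDerivAt (fun σ : ℝ => ∫ x, u x * φ (x + σ • e) ∂μ)
      (∫ x, u x * fderiv ℝ φ (x + σ • e) e ∂μ) σ := by
  have hφ' : Continuous (fderiv ℝ φ) := hφ.continuous_fderiv (by simp)
  obtain ⟨A, hA⟩ := hc.exists_bound_of_continuous hφ.continuous
  obtain ⟨B, hB⟩ : ∃ B, ∀ x, ‖fderiv ℝ φ x‖ ≤ B :=
    (hc.fderiv ℝ).exists_bound_of_continuous hφ'
  refine (hasDerivAt_integral_of_dominated_loc_of_deriv_le (𝕜 := ℝ)
    (F := fun σ x => u x * φ (x + σ • e)) (F' := fun σ x => u x * fderiv ℝ φ (x + σ • e) e)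
    (s := Set.univ)
    (bound := fun x => ‖u x‖ * (B * ‖e‖)) univ_mem (Eventually.of_forall fun σ => ?_) ?_ ?_
    (Eventually.of_forall fun x σ _ => ?_) (hu.norm.mul_const _)
    (Eventually.of_forall fun x σ _ => ?_)).2
  · exact hu.aestronglyMeasurable.mul
      (hφ.continuous.comp (by fun_prop)).aestronglyMeasurable
  · exact hu.mul_bdd (hφ.continuous.comp (by fun_prop)).aestronglyMeasurable
      (Eventually.of_forall fun x => hA _)
  · exact hu.aestronglyMeasurable.mul
      (Continuous.aestronglyMeasurable (by fun_prop))
  · rw [norm_mul]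
    gcongr
    exact (ContinuousLinearMap.le_opNorm _ _).trans (by gcongr; exact hB _)
  · have h1 : HasDerivAt (fun σ : ℝ => x + σ • e) e σ := by
      simpa using ((hasDerivAt_id σ).smul_const e).const_add x
    have h2 : HasFDerivAt φ (fderiv ℝ φ (x + σ • e)) (x + σ • e) :=
      ((hφ.differentiable (by simp)) _).hasFDerivAt
    exact (h2.comp_hasDerivAt σ h1).const_mul _

theorem continuous_integral_mul_translate {u ψ : E → ℝ} (hu : Integrable u μ)
    (hψ : Continuous ψ) (hc : HasCompactSupport ψ) (e : E) :
    Continuous (fun σ : ℝ => ∫ x, u x * ψ (x + σ • e) ∂μ) := by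
  obtain ⟨A, hA⟩ := hc.exists_bound_of_continuous hψ
  refine continuous_of_dominated (bound := fun x => ‖u x‖ * A) (fun σ => ?_)
    (fun σ => Eventually.of_forall fun x => ?_) (hu.norm.mul_const _)
    (Eventually.of_forall fun x => by fun_prop)
  · exact hu.aestronglyMeasurable.mul (Continuous.aestronglyMeasurable (by fun_prop))
  · rw [norm_mul]
    gcongr
    exact hA _

variable [FiniteDimensional ℝ E] [μ.IsAddHaarMeasure]

theorem integrable_translate_prod {g : E → ℝ} (hg : StronglyMeasurable g) (hgi : Integrable g μ)
    (e : E) (s : ℝ) :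
    Integrable (fun q : E × ℝ => g (q.1 - q.2 • e))
      (μ.prod (volume.restrict (Set.uIoc 0 s))) := by
  have hm : StronglyMeasurable (fun q : E × ℝ => g (q.1 - q.2 • e)) :=
    hg.comp_measurable (by fun_prop)
  rw [integrable_prod_iff' hm.aestronglyMeasurable]
  refine ⟨Eventually.of_forall fun σ => hgi.comp_sub_right (σ • e), ?_⟩
  simp_rw [integral_sub_right_eq_self (fun x => ‖g x‖)]
  exact integrableOn_const (by simp [Set.uIoc])

/-- A function with a weak derivative `g` in the direction `e` on `C` satisfies the fundamental
theorem of calculus on segments in `C` of direction `e`. -/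
theorem ae_translate_eq_sub_integral {u g : E → ℝ} {C W : Set E} {e : E} {s : ℝ}
    (hu : Integrable u μ) (hg : StronglyMeasurable g) (hgi : Integrable g μ)
    (hw : ∀ φ : E → ℝ, ContDiff ℝ ∞ φ → HasCompactSupport φ → tsupport φ ⊆ C →
      ∫ x, u x * fderiv ℝ φ x e ∂μ = - ∫ x, g x * φ x ∂μ)
    (hW : IsOpen W) (hWC : ∀ x ∈ W, ∀ σ ∈ Set.uIcc 0 s, x - σ • e ∈ C) :
    ∀ᵐ x ∂μ, x ∈ W → u (x - s • e) = u x - ∫ σ in 0..s, g (x - σ • e) := by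
  have hG := integrable_translate_prod hg hgi e s
  have hint : Integrable (fun x => ∫ σ in 0..s, g (x - σ • e)) μ := by
    rcases le_total 0 s with h | h
    · simp_rw [intervalIntegral.integral_of_le h]
      rw [Set.uIoc_of_le h] at hG
      exact hG.integral_prod_left
    · simp_rw [intervalIntegral.integral_of_ge h]
      rw [Set.uIoc_of_ge h] at hG
      exact hG.integral_prod_left.neg
  have hf : Integrable (fun x => u (x - s • e) - u x + ∫ σ in 0..s, g (x - σ • e)) μ :=
    ((hu.comp_sub_right _).sub hu).add hint
  have key := hW.ae_eq_zero_of_integral_contDiff_smul_eq_zero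
    (hf.locallyIntegrable.locallyIntegrableOn W) (μ := μ) fun φ hφ hc hsupp => ?_
  · filter_upwards [key] with x hx hxW
    linarith [hx hxW]
  obtain ⟨A, hA⟩ := hc.exists_bound_of_continuous hφ.continuous
  -- By `hWC` the shifted bump is still supported in `C`, so the weak derivative may be tested
  -- against it for every `σ`. Integrating in `σ` and moving the shift onto `u` and `g` gives the
  -- claim tested against `φ`.
  have hderiv : ∀ σ ∈ Set.uIcc 0 s,
      ∫ x, u x * fderiv ℝ φ (x + σ • e) e ∂μ = - ∫ x, g x * φ (x + σ • e) ∂μ := by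
    intro σ hσ
    have := hw (fun x => φ (x + σ • e)) (hφ.comp (by fun_prop))
      (hc.comp_homeomorph (Homeomorph.addRight (σ • e))) ?_
    · simpa only [fderiv_comp_add_right] using this
    · intro x hx
      have h1 : x + σ • e ∈ tsupport φ := by
        have := tsupport_comp_eq_preimage φ (Homeomorph.addRight (σ • e))
        have hx' : x ∈ tsupport (φ ∘ Homeomorph.addRight (σ • e)) := hx
        rw [this] at hx'
        exact hx'
      simpa using hWC _ (hsupp h1) σ hσ
  have hFTC := intervalIntegral.integral_eq_sub_of_hasDerivAt (a := 0) (b := s)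
    (fun σ _ => hasDerivAt_integral_mul_translate hu hφ hc e σ)
    (((continuous_integral_mul_translate hu (ψ := fun x => fderiv ℝ φ x e)
      ((hφ.continuous_fderiv (by simp)).clm_apply continuous_const)
      (hc.fderiv_apply (𝕜 := ℝ) e) e)).intervalIntegrable 0 s)
  rw [intervalIntegral.integral_congr hderiv, intervalIntegral.integral_neg] at hFTC
  have hshift : ∀ (v : E → ℝ) (σ : ℝ),
      ∫ x, v x * φ (x + σ • e) ∂μ = ∫ x, v (x - σ • e) * φ x ∂μ := by
    intro v σ
    rw [← integral_sub_right_eq_self (μ := μ) _ (σ • e)]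
    simp
  simp_rw [hshift] at hFTC
  have hswap : ∫ σ in 0..s, ∫ x, g (x - σ • e) * φ x ∂μ
      = ∫ x, (∫ σ in 0..s, g (x - σ • e)) * φ x ∂μ := by
    rw [intervalIntegral_integral_swap]
    · simp_rw [intervalIntegral.integral_mul_const]
    · have h2 : Integrable (fun q : E × ℝ => g (q.1 - q.2 • e) * φ q.1)
          (μ.prod (volume.restrict (Set.uIoc 0 s))) :=
        hG.mul_bdd (Continuous.aestronglyMeasurable (by have := hφ.continuous; fun_prop))
          (Eventually.of_forall fun q => hA q.1)
      exact h2.swap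
  rw [hswap] at hFTC
  have hbdd : ∀ v : E → ℝ, Integrable v μ → Integrable (fun x => v x * φ x) μ := fun v hv =>
    hv.mul_bdd hφ.continuous.aestronglyMeasurable (Eventually.of_forall hA)
  have hexp : ∀ x, φ x • (u (x - s • e) - u x + ∫ σ in 0..s, g (x - σ • e))
      = (u (x - s • e) * φ x - u x * φ x) + (∫ σ in 0..s, g (x - σ • e)) * φ x := by
    intro x
    simp only [smul_eq_mul]
    ring
  simp_rw [hexp]
  have i1 := hbdd _ (hu.comp_sub_right (s • e))
  have i2 := integral_add (i1.sub (hbdd _ hu)) (hbdd _ hint)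
  have i3 := integral_sub i1 (hbdd _ hu)
  simp only [Pi.sub_apply] at i2
  simp only [zero_smul, sub_zero] at hFTC
  linarith

end Translation

/-! ### One-sided essential limits on almost every line -/

section EssentialLimit

/-- Gives uniqueness of essential limits, which evaluating `limUnder` relies on. -/
instance essZeroRight_neBot : essZeroRight.NeBot := by
  refine inf_neBot_iff.2 fun {s} hs {t} ht => ?_
  obtain ⟨δ, hδ, hsub⟩ := mem_nhdsGT_iff_exists_Ioo_subset.1 hs
  by_contra hne
  rw [Set.not_nonempty_iff_eq_empty] at hne
  have h0 : volume (Set.Ioo (0 : ℝ) δ) = 0 :=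
    measure_mono_null (t := tᶜ) (fun x hx hxt => Set.notMem_empty x (hne.subset ⟨hsub hx, hxt⟩))
      (mem_ae_iff.1 ht)
  simp only [Real.volume_Ioo, sub_zero, ENNReal.ofReal_eq_zero] at h0
  exact absurd (Set.mem_Ioi.1 hδ) (not_lt.2 h0)

theorem eventually_essZeroRight {p : ℝ → Prop} {r : ℝ} (hr : 0 < r)
    (h : ∀ᵐ ε : ℝ, 0 < ε → ε < r → p ε) : ∀ᶠ ε in essZeroRight, p ε := by
  filter_upwards [mem_inf_of_right h, mem_inf_of_left (Ioo_mem_nhdsGT hr)] with ε h1 h2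
  exact h1 h2.1 h2.2

/-- Substituting `ε = t - s` turns the hypothesis into `v ε = v t - ∫ τ in ε..t, γ τ` for almost
every small `ε`, and the right side is continuous in `ε`. -/
theorem tendsto_essZeroRight_of_ae_eq {v γ : ℝ → ℝ} {t : ℝ} (ht : 0 < t) (hγ : Integrable γ)
    (h : ∀ᵐ s : ℝ, 0 < s → s < t → v (t - s) = v t - ∫ σ in 0..s, γ (t - σ)) :
    Tendsto v essZeroRight (𝓝 (v t - ∫ τ in 0..t, γ τ)) := by
  have h' : ∀ᵐ ε : ℝ, 0 < ε → ε < t → v ε = v t - ∫ τ in ε..t, γ τ := by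
    filter_upwards [(Measure.measurePreserving_sub_left volume t).quasiMeasurePreserving.ae h]
      with ε hε h0 h1
    have := hε (by linarith) (by linarith)
    rwa [intervalIntegral.integral_comp_sub_left (fun x => γ x), sub_sub_cancel, sub_zero] at this
  have hc : Continuous fun ε => ∫ τ in ε..t, γ τ := by
    have := (intervalIntegral.continuous_primitive (μ := volume) (f := γ)
      (fun a b => hγ.intervalIntegrable) t).neg
    refine this.congr fun ε => ?_
    rw [intervalIntegral.integral_symm t ε, Pi.neg_apply]
  have hlim : Tendsto (fun ε => v t - ∫ τ in ε..t, γ τ) essZeroRight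
      (𝓝 (v t - ∫ τ in 0..t, γ τ)) :=
    ((tendsto_const_nhds.sub (hc.tendsto 0)).mono_left nhdsWithin_le_nhds).mono_left inf_le_left
  refine hlim.congr' ?_
  filter_upwards [eventually_essZeroRight ht h'] with ε hε using hε.symm

variable {F : Type*} [MeasurableSpace F] {ν : Measure F}

theorem stronglyMeasurable_intervalIntegral {α : Type*} [MeasurableSpace α] {g : α → ℝ → ℝ}
    (hg : StronglyMeasurable (Function.uncurry g)) {b : α → ℝ} (hb : Measurable b) :
    StronglyMeasurable fun a => ∫ σ in 0..b a, g a σ := by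
  have h1 : ∀ a, ∫ σ in 0..b a, g a σ =
      (∫ σ, if 0 < σ ∧ σ ≤ b a then g a σ else 0) -
        ∫ σ, if b a < σ ∧ σ ≤ 0 then g a σ else 0 := by
    intro a
    rw [intervalIntegral, ← integral_indicator measurableSet_Ioc,
      ← integral_indicator measurableSet_Ioc]
    simp only [Set.indicator_apply, Set.mem_Ioc]
  simp_rw [h1]
  refine StronglyMeasurable.sub ?_ ?_
  · refine StronglyMeasurable.integral_prod_right (f := fun a σ =>
      if 0 < σ ∧ σ ≤ b a then g a σ else 0)
      (StronglyMeasurable.ite ?_ hg stronglyMeasurable_const)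
    exact (measurableSet_lt measurable_const measurable_snd).inter
      (measurableSet_le measurable_snd (hb.comp measurable_fst))
  · refine StronglyMeasurable.integral_prod_right (f := fun a σ =>
      if b a < σ ∧ σ ≤ 0 then g a σ else 0)
      (StronglyMeasurable.ite ?_ hg stronglyMeasurable_const)
    exact (measurableSet_lt (hb.comp measurable_fst) measurable_snd).inter
      (measurableSet_le measurable_snd measurable_const)

variable [SFinite ν]

/-- Fubini turns "for each `s`, for almost every point" into "for almost every line and almost every
`t`, for almost every `s`", so the limit exists on almost every line and equals `u (y, t) - ∫ τ in
0..t, g (y, τ)` for almost every `t`. -/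
theorem exists_integrable_essential_limit {u g : F × ℝ → ℝ} (hu : StronglyMeasurable u)
    (hui : Integrable u (ν.prod volume)) (hg : StronglyMeasurable g)
    (hgi : Integrable g (ν.prod volume)) {U : Set F} (hU : MeasurableSet U) {r : ℝ} (hr : 0 < r)
    (h : ∀ s ∈ Set.Ioo 0 r, ∀ᵐ p ∂ν.prod volume, p.1 ∈ U → p.2 ∈ Set.Ioo s r →
      u (p.1, p.2 - s) = u p - ∫ σ in 0..s, g (p.1, p.2 - σ)) :
    ∃ c : F → ℝ, Integrable c ν ∧
      ∀ᵐ y ∂ν, y ∈ U → Tendsto (fun ε => u (y, ε)) essZeroRight (𝓝 (c y)) := by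
  have hI : StronglyMeasurable fun p : F × ℝ => ∫ σ in 0..p.2, g (p.1, σ) :=
    stronglyMeasurable_intervalIntegral (g := fun (p : F × ℝ) σ => g (p.1, σ))
      (hg.comp_measurable (by fun_prop)) measurable_snd
  have hJ : StronglyMeasurable fun q : ℝ × (F × ℝ) => ∫ σ in 0..q.1, g (q.2.1, q.2.2 - σ) :=
    stronglyMeasurable_intervalIntegral (g := fun (q : ℝ × (F × ℝ)) σ => g (q.2.1, q.2.2 - σ))
      (hg.comp_measurable (by fun_prop)) measurable_fst
  have h1 : ∀ᵐ s : ℝ, ∀ᵐ p ∂ν.prod volume, 0 < s → p.1 ∈ U → s < p.2 → p.2 < r →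
      u (p.1, p.2 - s) = u p - ∫ σ in 0..s, g (p.1, p.2 - σ) := by
    refine Eventually.of_forall fun s => ?_
    by_cases hs : s ∈ Set.Ioo 0 r
    · filter_upwards [h s hs] with p hp _ h2 h3 h4 using hp h2 ⟨h3, h4⟩
    · exact Eventually.of_forall fun p h1 _ h3 h4 => absurd ⟨h1, h3.trans h4⟩ hs
  -- Exchanging the quantifiers needs joint measurability of the exceptional set; this is why `u`
  -- and `g` are strongly measurable and not merely almost everywhere so.
  rw [Measure.ae_ae_comm] at h1
  swap
  · have hE : MeasurableSet {q : ℝ × (F × ℝ) | u (q.2.1, q.2.2 - q.1)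
        = u q.2 - ∫ σ in 0..q.1, g (q.2.1, q.2.2 - σ)} :=
      StronglyMeasurable.measurableSet_eq_fun (hu.comp_measurable (by fun_prop))
        ((hu.comp_measurable measurable_snd).sub hJ)
    have hA : MeasurableSet {q : ℝ × (F × ℝ) | 0 < q.1} :=
      measurableSet_lt measurable_const measurable_fst
    have hB : MeasurableSet {q : ℝ × (F × ℝ) | q.2.1 ∈ U} :=
      hU.preimage (by fun_prop : Measurable fun q : ℝ × (F × ℝ) => q.2.1)
    have hC : MeasurableSet {q : ℝ × (F × ℝ) | q.1 < q.2.2} :=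
      measurableSet_lt measurable_fst (by fun_prop)
    have hD : MeasurableSet {q : ℝ × (F × ℝ) | q.2.2 < r} :=
      measurableSet_lt (by fun_prop) measurable_const
    exact hA.imp (hB.imp (hC.imp (hD.imp hE)))
  have h2 := Measure.ae_ae_of_ae_prod h1
  have hslice : ∀ᵐ y ∂ν, y ∈ U → ∀ᵐ t : ℝ, t ∈ Set.Ioo 0 r →
      Tendsto (fun ε => u (y, ε)) essZeroRight (𝓝 (u (y, t) - ∫ τ in 0..t, g (y, τ))) := by
    filter_upwards [h2, hgi.prod_right_ae] with y hy hgy hyU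
    filter_upwards [hy] with t hts ht
    refine tendsto_essZeroRight_of_ae_eq (v := fun t => u (y, t)) (γ := fun t => g (y, t))
      ht.1 hgy ?_
    filter_upwards [hts] with s hs h0 h3 using hs h0 hyU h3 ht.2
  have hint : Integrable (fun p : F × ℝ => u p - ∫ τ in 0..p.2, g (p.1, τ))
      (ν.prod (volume.restrict (Set.Ioo 0 r))) := by
    have hle : ν.prod (volume.restrict (Set.Ioo 0 r)) ≤ ν.prod volume := by
      have := Measure.prod_restrict (μ := ν) (ν := (volume : Measure ℝ)) Set.univ (Set.Ioo 0 r)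
      rw [Measure.restrict_univ] at this
      rw [this]
      exact Measure.restrict_le_self
    refine (hui.mono_measure hle).sub ?_
    have hG : Integrable (fun p : F × ℝ => ∫ τ, ‖g (p.1, τ)‖)
        (ν.prod (volume.restrict (Set.Ioo 0 r))) :=
      hgi.norm.integral_prod_left.comp_fst _
    refine hG.mono' hI.aestronglyMeasurable ?_
    have : ∀ᵐ y ∂ν, ∀ t, ‖∫ τ in 0..t, g (y, τ)‖ ≤ ∫ τ, ‖g (y, τ)‖ := by
      filter_upwards [hgi.prod_right_ae] with y hy t
      refine intervalIntegral.norm_integral_le_integral_norm_uIoc.trans ?_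
      exact setIntegral_le_integral hy.norm (Eventually.of_forall fun τ => norm_nonneg _)
    have h3 := Measure.quasiMeasurePreserving_fst
      (μ := ν) (ν := (volume.restrict (Set.Ioo 0 r) : Measure ℝ))
    filter_upwards [h3.ae this] with p hp using hp p.2
  -- The limit does not depend on `t`, so it equals its own mean over `(0, r)`; in this form
  -- integrability in `y` is inherited from the product.
  refine ⟨fun y => r⁻¹ * ∫ t in Set.Ioo 0 r, (u (y, t) - ∫ τ in 0..t, g (y, τ)),
    hint.integral_prod_left.const_mul _, ?_⟩
  filter_upwards [hslice] with y hy hyU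
  have hy' := hy hyU
  rw [← ae_restrict_iff' measurableSet_Ioo] at hy'
  have : (ae (volume.restrict (Set.Ioo 0 r))).NeBot := by
    rw [ae_neBot, Ne, Measure.restrict_eq_zero]
    simp [hr]
  obtain ⟨t₀, ht₀⟩ := hy'.exists
  have hconst : ∫ t in Set.Ioo 0 r, (u (y, t) - ∫ τ in 0..t, g (y, τ))
      = ∫ t in Set.Ioo 0 r, (u (y, t₀) - ∫ τ in 0..t₀, g (y, τ)) :=
    integral_congr_ae (hy'.mono fun t ht => tendsto_nhds_unique ht ht₀)
  rw [hconst]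
  convert ht₀ using 2
  simp only [integral_const, smul_eq_mul, measureReal_restrict_apply_univ, Real.volume_real_Ioo,
    sub_zero, max_eq_left hr.le]
  field_simp

end EssentialLimit

/-! ### Coordinates normal to a hyperplane, and surface measure -/

section NormalCoordinates

variable {V : Type*} [NormedAddCommGroup V] [InnerProductSpace ℝ V]

/-- Coordinates `(y, t) ↦ x₀ + y + t e` adapted to the hyperplane through `x₀` normal to `e`. -/
def normalCoord (x₀ e : V) (p : (ℝ ∙ e)ᗮ × ℝ) : V := x₀ + (p.1 + p.2 • e)

theorem inner_orthogonal_span_singleton {e : V} (y : (ℝ ∙ e)ᗮ) : inner ℝ e (y : V) = 0 :=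
  Submodule.mem_orthogonal_singleton_iff_inner_right.1 y.2

theorem inner_normalCoord_sub {x₀ e : V} (he : ‖e‖ = 1) (p : (ℝ ∙ e)ᗮ × ℝ) :
    inner ℝ e (normalCoord x₀ e p - x₀) = p.2 := by
  simp [normalCoord, inner_add_right, inner_smul_right, inner_orthogonal_span_singleton, he]

/-- The linear part of `normalCoord`. -/
def normalCoordLinear (e : V) (he : ‖e‖ = 1) : WithLp 2 ((ℝ ∙ e)ᗮ × ℝ) →ₗᵢ[ℝ] V where
  toFun p := p.fst + p.snd • e
  map_add' p q := by simp [add_smul]; abel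
  map_smul' a p := by simp [mul_smul]
  norm_map' p := by
    have h := norm_add_sq_real (p.fst : V) (p.snd • e)
    rw [inner_smul_right, real_inner_comm, inner_orthogonal_span_singleton, norm_smul, he] at h
    have h2 := WithLp.prod_norm_sq_eq_of_L2 p
    have h3 : ‖(p.fst : V) + p.snd • e‖ ^ 2 = ‖p‖ ^ 2 := by
      rw [h, h2]
      simp
    exact (pow_left_inj₀ (norm_nonneg _) (norm_nonneg _) two_ne_zero).1 h3

theorem isometry_hyperplane (x₀ e : V) : Isometry fun y : (ℝ ∙ e)ᗮ => x₀ + (y : V) :=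
  (IsometryEquiv.addLeft x₀).isometry.comp isometry_subtype_coe

theorem range_hyperplane (x₀ e : V) :
    Set.range (fun y : (ℝ ∙ e)ᗮ => x₀ + (y : V)) = {x | inner ℝ e (x - x₀) = 0} := by
  ext x
  constructor
  · rintro ⟨y, rfl⟩
    simp [inner_orthogonal_span_singleton]
  · intro hx
    exact ⟨⟨x - x₀, Submodule.mem_orthogonal_singleton_iff_inner_right.2 hx⟩, by simp⟩

variable [FiniteDimensional ℝ V]

theorem finrank_orthogonal_span_singleton_add_one {e : V} (he : ‖e‖ = 1) :
    Module.finrank ℝ (ℝ ∙ e)ᗮ + 1 = Module.finrank ℝ V := by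
  have h := Submodule.finrank_add_finrank_orthogonal (ℝ ∙ e)
  rw [finrank_span_singleton (by rintro rfl; simp at he)] at h
  omega

variable [MeasurableSpace V] [BorelSpace V]

theorem measurePreserving_normalCoord (x₀ : V) {e : V} (he : ‖e‖ = 1) :
    MeasurePreserving (normalCoord x₀ e) (volume.prod volume) volume := by
  have hrank : Module.finrank ℝ (WithLp 2 ((ℝ ∙ e)ᗮ × ℝ)) = Module.finrank ℝ V := by
    rw [← finrank_orthogonal_span_singleton_add_one he,
      (WithLp.linearEquiv 2 ℝ ((ℝ ∙ e)ᗮ × ℝ)).finrank_eq, Module.finrank_prod,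
      Module.finrank_self]
  have h1 := ((normalCoordLinear e he).toLinearIsometryEquiv hrank).measurePreserving
  have h2 := WithLp.volume_preserving_toLp (ℝ ∙ e)ᗮ ℝ
  exact (measurePreserving_add_left volume x₀).comp (h1.comp h2)

theorem measurableEmbedding_hyperplane (x₀ e : V) :
    MeasurableEmbedding fun y : (ℝ ∙ e)ᗮ => x₀ + (y : V) :=
  (isometry_hyperplane x₀ e).isClosedEmbedding.measurableEmbedding

/-- Isometries preserve normalized Hausdorff measure, which on the `(d - 1)`-dimensional space `(ℝ ∙
e)ᗮ` is Lebesgue measure. Surface null sets thereby become null sets of normal lines. -/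
theorem map_volume_hyperplane {d : ℕ} (x₀ : EuclideanSpace ℝ (Fin d))
    {e : EuclideanSpace ℝ (Fin d)} (he : ‖e‖ = 1) :
    Measure.map (fun y : (ℝ ∙ e)ᗮ => x₀ + (y : EuclideanSpace ℝ (Fin d))) volume
      = (surfaceMeasure d).restrict {x | inner ℝ e (x - x₀) = 0} := by
  have h := finrank_orthogonal_span_singleton_add_one he
  rw [finrank_euclideanSpace_fin] at h
  -- A unit vector forces `d ≥ 1`, so the truncated subtraction is harmless.
  have h' : d - 1 = Module.finrank ℝ (ℝ ∙ e)ᗮ := by omega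
  rw [← range_hyperplane, surfaceMeasure, h',
    ← (isometry_hyperplane x₀ e).map_euclideanHausdorffMeasure,
    InnerProductSpace.euclideanHausdorffMeasure_eq_volume]

end NormalCoordinates

/-! ### Traces of `H¹` functions on flat boundary pieces -/

section Trace

variable {d : ℕ} {K : Set (EuclideanSpace ℝ (Fin d))} {w : EuclideanSpace ℝ (Fin d) → ℝ}
  {x₀ e : EuclideanSpace ℝ (Fin d)} {R : ℝ}

/-- Boundedness turns `L²` into `L¹`, and extension by zero is harmless because test functions are
supported in `K`. The strongly measurable representatives serve the Fubini argument. -/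
theorem MemH1.exists_directional (hK : IsOpen K) (hb : Bornology.IsBounded K) (hw : MemH1 K w)
    (e : EuclideanSpace ℝ (Fin d)) :
    ∃ u g : EuclideanSpace ℝ (Fin d) → ℝ, StronglyMeasurable u ∧ Integrable u ∧
      StronglyMeasurable g ∧ Integrable g ∧ (∀ᵐ x, x ∈ K → u x = w x) ∧
      ∀ φ : EuclideanSpace ℝ (Fin d) → ℝ, ContDiff ℝ ∞ φ → HasCompactSupport φ →
        tsupport φ ⊆ K → ∫ x, u x * fderiv ℝ φ x e = - ∫ x, g x * φ x := by
  obtain ⟨hw2, G, hG2, hG⟩ := hw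
  have : IsFiniteMeasure (volume.restrict K) := ⟨by simpa using hb.measure_lt_top⟩
  have hwi : Integrable w (volume.restrict K) := hw2.integrable (by norm_num)
  have hGi : Integrable G (volume.restrict K) := hG2.integrable (by norm_num)
  have hGe : Integrable (fun x => ∑ i, e i * G x i) (volume.restrict K) :=
    integrable_finsetSum _ fun i _ =>
      ((EuclideanSpace.proj (𝕜 := ℝ) i).integrable_comp hGi).const_mul (e i)
  have hwI : Integrable (K.indicator w) := (integrable_indicator_iff hK.measurableSet).2 hwi
  have hGI : Integrable (K.indicator fun x => ∑ i, e i * G x i) :=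
    (integrable_indicator_iff hK.measurableSet).2 hGe
  refine ⟨hwI.1.mk _, hGI.1.mk _, hwI.1.stronglyMeasurable_mk, hwI.congr hwI.1.ae_eq_mk,
    hGI.1.stronglyMeasurable_mk, hGI.congr hGI.1.ae_eq_mk, ?_, fun φ hφ hc hs => ?_⟩
  · filter_upwards [hwI.1.ae_eq_mk] with x hx hxK
    rw [← hx, Set.indicator_of_mem hxK]
  have hφb := hc.exists_bound_of_continuous hφ.continuous
  have h1 : ∫ x, hwI.1.mk _ x * fderiv ℝ φ x e = ∫ x in K, w x * fderiv ℝ φ x e := by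
    rw [← integral_indicator hK.measurableSet]
    refine integral_congr_ae ?_
    filter_upwards [hwI.1.ae_eq_mk] with x hx
    rw [← hx]
    by_cases hxK : x ∈ K <;> simp [hxK]
  have h2 : ∫ x, hGI.1.mk _ x * φ x = ∫ x in K, (∑ i, e i * G x i) * φ x := by
    rw [← integral_indicator hK.measurableSet]
    refine integral_congr_ae ?_
    filter_upwards [hGI.1.ae_eq_mk] with x hx
    rw [← hx]
    by_cases hxK : x ∈ K <;> simp [hxK]
  have he : e = ∑ i, e i • EuclideanSpace.single i (1 : ℝ) := by
    have := (EuclideanSpace.basisFun (Fin d) ℝ).sum_repr e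
    simpa using this.symm
  have h3 : ∀ x, w x * fderiv ℝ φ x e
      = ∑ i, e i * (w x * fderiv ℝ φ x (EuclideanSpace.single i 1)) := by
    intro x
    conv_lhs => rw [he]
    simp only [map_sum, map_smul, smul_eq_mul, Finset.mul_sum]
    exact Finset.sum_congr rfl fun i _ => by ring
  have h4 : ∀ x, (∑ i, e i * G x i) * φ x = ∑ i, e i * (G x i * φ x) := by
    intro x
    simp only [Finset.sum_mul, mul_assoc]
  rw [h1, h2]
  simp_rw [h3, h4]
  rw [integral_finsetSum, integral_finsetSum, ← Finset.sum_neg_distrib]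
  · refine Finset.sum_congr rfl fun i _ => ?_
    rw [integral_const_mul, integral_const_mul, hG φ hφ hc hs i]
    ring
  · intro i _
    obtain ⟨A, hA⟩ := hφb
    exact (((EuclideanSpace.proj (𝕜 := ℝ) i).integrable_comp hGi).mul_bdd
      hφ.continuous.aestronglyMeasurable (Eventually.of_forall hA)).const_mul (e i)
  · intro i _
    have hφ' : Continuous fun x => fderiv ℝ φ x (EuclideanSpace.single i 1) :=
      (hφ.continuous_fderiv (by simp)).clm_apply continuous_const
    obtain ⟨B, hB⟩ := (hc.fderiv_apply (𝕜 := ℝ)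
      (EuclideanSpace.single i (1 : ℝ))).exists_bound_of_continuous hφ'
    exact (hwi.mul_bdd hφ'.aestronglyMeasurable (Eventually.of_forall hB)).const_mul (e i)

/-- An `H¹` function has an integrable trace on a flat piece of the boundary. -/
theorem MemH1.exists_trace (hK : IsOpen K) (hb : Bornology.IsBounded K) (hw : MemH1 K w)
    (he : ‖e‖ = 1) (hR : 0 < R)
    (hsub : ∀ y ∈ Metric.ball x₀ R, 0 < inner ℝ e (y - x₀) → y ∈ K) :
    ∃ c : EuclideanSpace ℝ (Fin d) → ℝ,
      IntegrableOn c {x | inner ℝ e (x - x₀) = 0} (surfaceMeasure d) ∧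
      ∀ᵐ x ∂(surfaceMeasure d).restrict {x | inner ℝ e (x - x₀) = 0},
        x ∈ Metric.ball x₀ (R / 2) →
          Tendsto (fun ε : ℝ => w (x + ε • e)) essZeroRight (𝓝 (c x)) := by
  obtain ⟨u, g, hum, hui, hgm, hgi, huw, hweak⟩ := hw.exists_directional hK hb e
  -- The cylinder of radius and height `R / 2` over the hyperplane fits into the half ball of radius
  -- `R`.
  set ρ := R / 2 with hρ
  have hρ0 : 0 < ρ := by positivity
  have hΦ := measurePreserving_normalCoord x₀ he
  have hmem : ∀ p : (ℝ ∙ e)ᗮ × ℝ, ‖p.1‖ < ρ → 0 < p.2 → p.2 < ρ → normalCoord x₀ e p ∈ K := by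
    intro p h1 h2 h3
    refine hsub _ ?_ (by rwa [inner_normalCoord_sub he])
    rw [mem_ball_iff_norm, normalCoord, add_sub_cancel_left]
    calc ‖(p.1 : EuclideanSpace ℝ (Fin d)) + p.2 • e‖
        ≤ ‖(p.1 : EuclideanSpace ℝ (Fin d))‖ + ‖p.2 • e‖ := norm_add_le _ _
      _ < ρ + ρ := by
        refine add_lt_add h1 ?_
        rwa [norm_smul, he, mul_one, Real.norm_of_nonneg h2.le]
      _ = R := by rw [hρ]; ring
  have hshift : ∀ (y : (ℝ ∙ e)ᗮ) (t s : ℝ),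
      normalCoord x₀ e (y, t) - s • e = normalCoord x₀ e (y, t - s) := by
    intro y t s
    simp only [normalCoord, sub_smul]
    abel
  have hfib : ∀ s ∈ Set.Ioo 0 ρ, ∀ᵐ p ∂(volume : Measure (ℝ ∙ e)ᗮ).prod (volume : Measure ℝ),
      p.1 ∈ Metric.ball (0 : (ℝ ∙ e)ᗮ) ρ → p.2 ∈ Set.Ioo s ρ →
      u (normalCoord x₀ e (p.1, p.2 - s)) = u (normalCoord x₀ e p)
        - ∫ σ in 0..s, g (normalCoord x₀ e (p.1, p.2 - σ)) := by
    intro s hs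
    -- `W` is the part of the cylinder above height `s`, so shifting down by at most `s` stays in
    -- `K`.
    have hkey := ae_translate_eq_sub_integral (μ := volume) (C := K) (e := e) (s := s)
      (W := {x | ‖(x - x₀) - inner ℝ e (x - x₀) • e‖ < ρ ∧ s < inner ℝ e (x - x₀) ∧
        inner ℝ e (x - x₀) < ρ}) hui hgm hgi hweak ?_ ?_
    · filter_upwards [hΦ.quasiMeasurePreserving.ae hkey] with p hp h1 h2
      have := hp ?_
      · simpa only [hshift] using this
      · simp only [inner_normalCoord_sub he]
        refine ⟨?_, h2⟩
        simpa [normalCoord] using h1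
    · have hc : Continuous fun x => inner ℝ e (x - x₀) := by fun_prop
      have hc' : Continuous fun x => ‖(x - x₀) - inner ℝ e (x - x₀) • e‖ := by fun_prop
      exact (isOpen_lt hc' continuous_const).and
        ((isOpen_lt continuous_const hc).and (isOpen_lt hc continuous_const))
    · rintro x ⟨h1, h2, h3⟩ σ hσ
      rw [Set.uIcc_of_le hs.1.le] at hσ
      have hy : (x - x₀) - inner ℝ e (x - x₀) • e ∈ (ℝ ∙ e)ᗮ := by
        rw [Submodule.mem_orthogonal_singleton_iff_inner_right, inner_sub_right,
          inner_smul_right, real_inner_self_eq_norm_sq, he]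
        ring
      have := hmem (⟨_, hy⟩, inner ℝ e (x - x₀) - σ) h1 (by simp; linarith [hσ.2])
        (by simp; linarith [hσ.1])
      convert this using 1
      simp only [normalCoord, sub_smul]
      abel
  obtain ⟨c, hci, hc⟩ := exists_integrable_essential_limit
    (ν := (volume : Measure (ℝ ∙ e)ᗮ))
    (hum.comp_measurable hΦ.measurable) (hΦ.integrable_comp_of_integrable hui)
    (hgm.comp_measurable hΦ.measurable) (hΦ.integrable_comp_of_integrable hgi)
    (U := Metric.ball 0 ρ) measurableSet_ball hρ0 hfib
  have hemb := measurableEmbedding_hyperplane x₀ e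
  have hext : ∀ y : (ℝ ∙ e)ᗮ, Function.extend (fun y : (ℝ ∙ e)ᗮ =>
      x₀ + (y : EuclideanSpace ℝ (Fin d))) c 0 (x₀ + y) = c y :=
    fun y => hemb.injective.extend_apply c 0 y
  refine ⟨Function.extend (fun y : (ℝ ∙ e)ᗮ => x₀ + (y : EuclideanSpace ℝ (Fin d))) c 0, ?_, ?_⟩
  · rw [IntegrableOn, ← map_volume_hyperplane x₀ he, hemb.integrable_map_iff]
    exact hci.congr (Eventually.of_forall fun y => (hext y).symm)
  · rw [← map_volume_hyperplane x₀ he, hemb.ae_map_iff]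
    -- On almost every normal line, `u` and `w` differ within `K` only on a null set, which
    -- essential limits ignore.
    have h1 := Measure.ae_ae_of_ae_prod (hΦ.quasiMeasurePreserving.ae huw)
    filter_upwards [hc, h1] with y hy h2 hyb
    have hyρ : ‖y‖ < ρ := by simpa using hyb
    rw [hext]
    refine (hy (by simpa using hyρ)).congr' (eventually_essZeroRight hρ0 ?_)
    filter_upwards [h2] with ε hε h0 h3
    have := hε (hmem _ hyρ h0 h3)
    rw [Function.comp_apply, this, normalCoord, add_assoc]

end Trace

/-! ### Open sets with flat frontier inside a ball -/

section HalfBall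

variable {V : Type*} [NormedAddCommGroup V] [InnerProductSpace ℝ V] {x e y : V} {R : ℝ}

/-- The open half of `ball x R` on the side of `e`. -/
def halfBall (x e : V) (R : ℝ) : Set V := Metric.ball x R ∩ {y | 0 < inner ℝ e (y - x)}

theorem convex_halfBall (x e : V) (R : ℝ) : Convex ℝ (halfBall x e R) := by
  refine (convex_ball x R).inter ?_
  have h : {y : V | 0 < inner ℝ e (y - x)} = {y | inner ℝ e x < innerSL ℝ e y} := by
    ext y
    simp [inner_sub_right]
  rw [h]
  exact convex_halfSpace_gt (innerSL ℝ e).isLinear _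

/-- An open set that meets the closed half of a ball meets the open half. -/
theorem exists_mem_halfBall {Q : Set V} (hQ : IsOpen Q) (he : ‖e‖ = 1) (hy : y ∈ Q)
    (hyb : y ∈ Metric.ball x R) (h : 0 ≤ inner ℝ e (y - x)) : ∃ z ∈ Q, z ∈ halfBall x e R := by
  have hc : Tendsto (fun t : ℝ => y + t • e) (𝓝[>] 0) (𝓝 y) := by
    have : Continuous fun t : ℝ => y + t • e := by fun_prop
    simpa using (this.tendsto 0).mono_left nhdsWithin_le_nhds
  obtain ⟨t, ⟨ht1, ht2⟩, ht0⟩ := ((hc.eventually ((hQ.inter Metric.isOpen_ball).mem_nhds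
    ⟨hy, hyb⟩)).and self_mem_nhdsWithin).exists
  refine ⟨_, ht1, ht2, ?_⟩
  have : inner ℝ e (y + t • e - x) = inner ℝ e (y - x) + t := by
    rw [add_sub_right_comm, inner_add_right, inner_smul_right, real_inner_self_eq_norm_sq, he]
    ring
  rw [Set.mem_ofPred_eq, this]
  exact add_pos_of_nonneg_of_pos h ht0

/-- The half ball is convex, hence connected, and avoids the frontier, so it cannot meet both `K`
and the complement of its closure. -/
theorem halfBall_subset_or_disjoint {K : Set V} (hK : IsOpen K)
    (hflat : ∀ y ∈ frontier K, y ∈ Metric.ball x R → inner ℝ e (y - x) = 0) :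
    halfBall x e R ⊆ K ∨ Disjoint (halfBall x e R) (closure K) := by
  have hcover : halfBall x e R ⊆ K ∪ (closure K)ᶜ := by
    rintro y ⟨hyb, hye⟩
    by_cases hyK : y ∈ K
    · exact Or.inl hyK
    · refine Or.inr fun hyc => ?_
      have hyf : y ∈ frontier K := by
        rw [frontier, hK.interior_eq]
        exact ⟨hyc, hyK⟩
      rw [Set.mem_ofPred_eq, hflat y hyf hyb] at hye
      exact lt_irrefl _ hye
  rcases (convex_halfBall x e R).isPreconnected.subset_or_subset hK isClosed_closure.isOpen_compl
    (Set.disjoint_left.2 fun y hy hyc => hyc (subset_closure hy)) hcover with h | h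
  · exact Or.inl h
  · exact Or.inr (Set.disjoint_left.2 h)

theorem mem_iff_of_halfBall {K : Set V} (hK : IsOpen K) (he : ‖e‖ = 1)
    (hneg : halfBall x (-e) R ⊆ K) (hpos : Disjoint (halfBall x e R) K) :
    ∀ y ∈ Metric.ball x R, (y ∈ K ↔ inner ℝ e (y - x) < 0) := by
  intro y hy
  refine ⟨fun hyK => ?_, fun h => hneg ⟨hy, ?_⟩⟩
  · by_contra! h
    obtain ⟨z, hzK, hz⟩ := exists_mem_halfBall hK he hyK hy h
    exact Set.disjoint_left.1 hpos hz hzK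
  · rw [Set.mem_ofPred_eq, inner_neg_left]
    linarith

theorem disjoint_ball_of_halfBall {Q : Set V} (hQ : IsOpen Q) (he : ‖e‖ = 1)
    (hneg : Disjoint (halfBall x (-e) R) Q) (hpos : Disjoint (halfBall x e R) Q) :
    Disjoint Q (Metric.ball x R) := by
  refine Set.disjoint_left.2 fun y hyQ hy => ?_
  rcases le_total 0 (inner ℝ e (y - x)) with h | h
  · obtain ⟨z, hzQ, hz⟩ := exists_mem_halfBall hQ he hyQ hy h
    exact Set.disjoint_left.1 hpos hz hzQ
  · obtain ⟨z, hzQ, hz⟩ := exists_mem_halfBall hQ (e := -e) (by rwa [norm_neg]) hyQ hy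
      (by rw [inner_neg_left]; linarith)
    exact Set.disjoint_left.1 hneg hz hzQ

/-- A flat boundary point without slit has the set on exactly one side. -/
theorem exists_side {K : Set V} (hK : IsOpen K) (hint : interior (closure K) = K)
    (hx : x ∈ frontier K) (he : ‖e‖ = 1) (hR : 0 < R)
    (hflat : ∀ y ∈ frontier K, y ∈ Metric.ball x R → inner ℝ e (y - x) = 0) :
    ∃ n : V, (n = e ∨ n = -e) ∧ halfBall x (-n) R ⊆ K ∧ Disjoint (halfBall x n R) (closure K) := by
  have hflat' : ∀ y ∈ frontier K, y ∈ Metric.ball x R → inner ℝ (-e) (y - x) = 0 := by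
    intro y h1 h2
    rw [inner_neg_left, hflat y h1 h2, neg_zero]
  have hxK : x ∉ K := fun h => hx.2 (by rwa [hK.interior_eq])
  rcases halfBall_subset_or_disjoint hK hflat with h1 | h1 <;>
    rcases halfBall_subset_or_disjoint hK hflat' with h2 | h2
  -- Both halves in `K` would make a slit, excluded by `hint`; if neither half meets `K`, then `x`
  -- is not in its closure.
  · refine absurd ?_ hxK
    rw [← hint, mem_interior]
    refine ⟨Metric.ball x R, fun y hy => mem_closure_iff.2 fun O hO hyO => ?_,
      Metric.isOpen_ball, Metric.mem_ball_self hR⟩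
    rcases le_total 0 (inner ℝ e (y - x)) with h | h
    · obtain ⟨z, hzO, hz⟩ := exists_mem_halfBall hO he hyO hy h
      exact ⟨z, hzO, h1 hz⟩
    · obtain ⟨z, hzO, hz⟩ := exists_mem_halfBall hO (e := -e) (by rwa [norm_neg]) hyO hy
        (by rw [inner_neg_left]; linarith)
      exact ⟨z, hzO, h2 hz⟩
  · exact ⟨-e, Or.inr rfl, by rwa [neg_neg], h2⟩
  · exact ⟨e, Or.inl rfl, h2, h1⟩
  · have := disjoint_ball_of_halfBall hK he (h2.mono_right subset_closure)
      (h1.mono_right subset_closure)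
    obtain ⟨z, hzb, hzK⟩ := mem_closure_iff.1 hx.1 _ Metric.isOpen_ball (Metric.mem_ball_self hR)
    exact absurd hzb (Set.disjoint_left.1 this hzK)

end HalfBall

/-! ### Outward normals -/

section Normal

variable {d : ℕ} {K : Set (EuclideanSpace ℝ (Fin d))} {x y n n' : EuclideanSpace ℝ (Fin d)} {R : ℝ}

theorem isOutwardNormal_of_mem_iff (hn : ‖n‖ = 1)
    (hK : ∀ y ∈ Metric.ball x R, (y ∈ K ↔ inner ℝ n (y - x) < 0)) (hy : y ∈ Metric.ball x R)
    (hxy : inner ℝ n (y - x) = 0) : IsOutwardNormal K y n := by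
  obtain ⟨r, hr, hsub⟩ := Metric.isOpen_iff.1 Metric.isOpen_ball y hy
  refine ⟨hn, r, hr, fun z hz => ?_⟩
  rw [hK z (hsub hz), ← sub_add_sub_cancel z y x, inner_add_right, hxy, add_zero]

theorem IsOutwardNormal.exists_mem_ball (h : IsOutwardNormal K x n) {r : ℝ} (hr : 0 < r) :
    ∃ z ∈ Metric.ball x r, z ∈ K := by
  obtain ⟨hn, s, hs, hK⟩ := h
  have hpos : 0 < min r s / 2 := by positivity
  have hlt : min r s / 2 < min r s := half_lt_self (lt_min hr hs)
  have hb : ‖x - (min r s / 2) • n - x‖ = min r s / 2 := by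
    rw [sub_sub_cancel_left, norm_neg, norm_smul, hn, mul_one, Real.norm_of_nonneg hpos.le]
  refine ⟨x - (min r s / 2) • n, ?_, (hK _ ?_).2 ?_⟩
  · rw [mem_ball_iff_norm, hb]
    exact hlt.trans_le (min_le_left _ _)
  · rw [mem_ball_iff_norm, hb]
    exact hlt.trans_le (min_le_right _ _)
  · rw [sub_sub_cancel_left, inner_neg_right, inner_smul_right, real_inner_self_eq_norm_sq, hn]
    linarith

/-- For distinct unit vectors, a small step from `x` along `n - n'` is outside `K` according to `n`
and inside according to `n'`. -/
theorem IsOutwardNormal.unique (h : IsOutwardNormal K x n) (h' : IsOutwardNormal K x n') :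
    n = n' := by
  obtain ⟨hn, r, hr, hK⟩ := h
  obtain ⟨hn', r', hr', hK'⟩ := h'
  by_contra hne
  have hlt : inner ℝ n n' < 1 := (inner_lt_one_iff_real_of_norm_eq_one hn hn').2 hne
  have hc : Tendsto (fun t : ℝ => x + t • (n - n')) (𝓝[>] 0) (𝓝 x) := by
    have : Continuous fun t : ℝ => x + t • (n - n') := by fun_prop
    simpa using (this.tendsto 0).mono_left nhdsWithin_le_nhds
  obtain ⟨t, ⟨ht1, ht2⟩, ht0⟩ := ((hc.eventually (inter_mem (Metric.ball_mem_nhds x hr)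
    (Metric.ball_mem_nhds x hr'))).and self_mem_nhdsWithin).exists
  have ht0' : 0 < t := ht0
  have h1 := (hK _ ht1).not.2 ?_
  · refine h1 ((hK' _ ht2).2 ?_)
    rw [add_sub_cancel_left, inner_smul_right, inner_sub_right, real_inner_self_eq_norm_sq, hn',
      real_inner_comm]
    nlinarith
  · rw [add_sub_cancel_left, inner_smul_right, inner_sub_right, real_inner_self_eq_norm_sq, hn]
    nlinarith

end Normal

/-! ### Flatness of cell boundaries off a null set -/

section Flat

variable {d : ℕ}

/-- Seen from a common point, the second hyperplane cuts a proper linear subspace out of the first,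
which is Lebesgue-null there. -/
theorem surfaceMeasure_inter_hyperplane {a b : EuclideanSpace ℝ (Fin d)} {s t : ℝ} (ha : a ≠ 0)
    (hab : ¬ {x : EuclideanSpace ℝ (Fin d) | inner ℝ a x = s} ⊆ {x | inner ℝ b x = t}) :
    surfaceMeasure d ({x | inner ℝ a x = s} ∩ {x | inner ℝ b x = t}) = 0 := by
  rcases ({x : EuclideanSpace ℝ (Fin d) | inner ℝ a x = s} ∩
    {x | inner ℝ b x = t}).eq_empty_or_nonempty with h | ⟨x₀, hx1, hx2⟩
  · rw [h, measure_empty]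
  have hx1' : inner ℝ a x₀ = s := hx1
  have hx2' : inner ℝ b x₀ = t := hx2
  have hn : ‖a‖ ≠ 0 := norm_ne_zero_iff.2 ha
  have he : ‖‖a‖⁻¹ • a‖ = 1 := by
    rw [norm_smul, norm_inv, norm_norm, inv_mul_cancel₀ hn]
  have hH : {x : EuclideanSpace ℝ (Fin d) | inner ℝ a x = s}
      = {x | inner ℝ (‖a‖⁻¹ • a) (x - x₀) = 0} := by
    ext x
    simp only [Set.mem_ofPred_eq, inner_smul_left, inner_sub_right, hx1', sub_eq_zero]
    simp [hn]
  have hmb : MeasurableSet {x : EuclideanSpace ℝ (Fin d) | inner ℝ b x = t} :=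
    (isClosed_eq (by fun_prop) continuous_const).measurableSet
  rw [Set.inter_comm, ← Measure.restrict_apply hmb, hH, ← map_volume_hyperplane x₀ he,
    (measurableEmbedding_hyperplane x₀ _).map_apply]
  set p : Submodule ℝ (ℝ ∙ (‖a‖⁻¹ • a))ᗮ :=
    LinearMap.ker ((innerSL ℝ b).toLinearMap ∘ₗ (ℝ ∙ (‖a‖⁻¹ • a))ᗮ.subtype) with hp
  have hpre : (fun y : (ℝ ∙ (‖a‖⁻¹ • a))ᗮ => x₀ + (y : EuclideanSpace ℝ (Fin d))) ⁻¹'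
      {x | inner ℝ b x = t} = p := by
    ext y
    simp [hp, inner_add_right, hx2']
  rw [hpre]
  refine Measure.addHaar_submodule _ p fun htop => hab fun x hx => ?_
  rw [hH, ← range_hyperplane] at hx
  obtain ⟨y, rfl⟩ := hx
  have : y ∈ (p : Set _) := by rw [htop]; trivial
  rw [← hpre] at this
  exact this

/-- Off a null set, the frontiers of finitely many polytopal cells are locally contained in one
hyperplane. -/
theorem exists_null_forall_flat {S : Finset (Set (EuclideanSpace ℝ (Fin d)))}
    (hS : ∀ K ∈ S, IsPolytopalCell K) :
    ∃ N : Set (EuclideanSpace ℝ (Fin d)), surfaceMeasure d N = 0 ∧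
      ∀ x ∈ ⋃ K ∈ S, frontier K, x ∉ N → ∃ e : EuclideanSpace ℝ (Fin d), ‖e‖ = 1 ∧ ∃ R > 0,
        ∀ K ∈ S, ∀ y ∈ frontier K, y ∈ Metric.ball x R → inner ℝ e (y - x) = 0 := by
  classical
  have hex : ∀ K, ∃ H : Finset (EuclideanSpace ℝ (Fin d) × ℝ), K ∈ S →
      (∀ h ∈ H, h.1 ≠ 0) ∧ frontier K ⊆ ⋃ h ∈ H, {x | inner ℝ h.1 x = h.2} := by
    intro K
    by_cases hK : K ∈ S
    · obtain ⟨H, h1, h2⟩ := (hS K hK).frontier_subset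
      exact ⟨H, fun _ => ⟨h1, h2⟩⟩
    · exact ⟨∅, fun h => absurd h hK⟩
  choose H hH using hex
  let A := S.biUnion H
  have hA0 : ∀ h ∈ A, h.1 ≠ 0 := by
    intro h hh
    obtain ⟨K, hK, hhK⟩ := Finset.mem_biUnion.1 hh
    exact (hH K hK).1 h hhK
  let P : EuclideanSpace ℝ (Fin d) × ℝ → Set (EuclideanSpace ℝ (Fin d)) :=
    fun h => {x | inner ℝ h.1 x = h.2}
  have hAf : ∀ K ∈ S, ∀ y ∈ frontier K, ∃ h ∈ A, y ∈ P h := by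
    intro K hK y hy
    obtain ⟨h, hh, hyh⟩ := Set.mem_iUnion₂.1 ((hH K hK).2 hy)
    exact ⟨h, Finset.mem_biUnion.2 ⟨K, hK, hh⟩, hyh⟩
  refine ⟨⋃ h ∈ A, ⋃ k ∈ A, {x | x ∈ P h ∩ P k ∧ ¬ P h ⊆ P k}, ?_, fun x hx hxN => ?_⟩
  · refine (measure_biUnion_null_iff A.countable_toSet).2 fun h hh =>
      (measure_biUnion_null_iff A.countable_toSet).2 fun k _ => ?_
    by_cases hk : P h ⊆ P k
    · simp [hk]
    · exact measure_mono_null (fun x hx => hx.1) (surfaceMeasure_inter_hyperplane (hA0 h hh) hk)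
  obtain ⟨K, hK, hxK⟩ := Set.mem_iUnion₂.1 hx
  obtain ⟨h, hh, hxh⟩ := hAf K hK x hxK
  have hn : ‖h.1‖ ≠ 0 := norm_ne_zero_iff.2 (hA0 h hh)
  -- `R` keeps the ball away from the finitely many hyperplanes missing `x`; those through `x` are
  -- all contained in `P h` because `x ∉ N`.
  have hclosed : IsClosed (⋃ k ∈ A.filter fun k => x ∉ P k, P k) :=
    (Finset.finite_toSet _).isClosed_biUnion fun k _ =>
      isClosed_eq (by fun_prop) continuous_const
  obtain ⟨R, hR, hball⟩ := Metric.isOpen_iff.1 hclosed.isOpen_compl x (by simp)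
  refine ⟨‖h.1‖⁻¹ • h.1, by rw [norm_smul, norm_inv, norm_norm, inv_mul_cancel₀ hn], R, hR,
    fun L hL y hy hyb => ?_⟩
  obtain ⟨k, hk, hyk⟩ := hAf L hL y hy
  have hxk : x ∈ P k := by
    by_contra hxk
    exact hball hyb (Set.mem_iUnion₂.2 ⟨k, Finset.mem_filter.2 ⟨hk, hxk⟩, hyk⟩)
  have hkh : P k ⊆ P h := by
    by_contra hkh
    exact hxN (Set.mem_iUnion₂.2 ⟨k, hk, Set.mem_iUnion₂.2 ⟨h, hh, ⟨hxk, hxh⟩, hkh⟩⟩)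
  have hyh : inner ℝ h.1 y = h.2 := hkh hyk
  have hxh' : inner ℝ h.1 x = h.2 := hxh
  rw [inner_smul_left, inner_sub_right, hyh, hxh', sub_self, mul_zero]

end Flat

/-! ### The mesh near a flat point -/

section LocalStructure

variable {d : ℕ} {Ω : Set (EuclideanSpace ℝ (Fin d))} (M : Mesh Ω)
  {x e : EuclideanSpace ℝ (Fin d)} {R : ℝ}

theorem isOpen_of_interior_closure_eq (hΩ : interior (closure Ω) = Ω) : IsOpen Ω := by
  rw [← hΩ]
  exact isOpen_interior

theorem Mesh.cell_subset (hΩ : interior (closure Ω) = Ω) {K : Set (EuclideanSpace ℝ (Fin d))}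
    (hK : K ∈ M.cells) : K ⊆ Ω := by
  rw [← hΩ, M.cover]
  exact interior_maximal (subset_closure.trans (Set.subset_biUnion_of_mem (u := closure) hK))
    (M.isPolytopalCell K hK).isOpen

theorem Mesh.frontier_subset (hΩ : interior (closure Ω) = Ω) :
    frontier Ω ⊆ ⋃ K ∈ M.cells, frontier K := by
  intro x hx
  have hxc : x ∈ closure Ω := hx.1
  rw [M.cover] at hxc
  obtain ⟨K, hK, hxK⟩ := Set.mem_iUnion₂.1 hxc
  refine Set.mem_iUnion₂.2 ⟨K, hK, hxK, fun hxi => hx.2 ?_⟩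
  rw [(M.isPolytopalCell K hK).isOpen.interior_eq] at hxi
  rw [(isOpen_of_interior_closure_eq hΩ).interior_eq]
  exact M.cell_subset hΩ hK hxi

theorem Mesh.exists_halfBall_subset {n : EuclideanSpace ℝ (Fin d)}
    (hflat : ∀ K ∈ M.cells, ∀ y ∈ frontier K, y ∈ Metric.ball x R → inner ℝ n (y - x) = 0)
    (hmeet : ¬ Disjoint (halfBall x n R) (closure Ω)) :
    ∃ L ∈ M.cells, halfBall x n R ⊆ L := by
  obtain ⟨y, hy, hyc⟩ := Set.not_disjoint_iff.1 hmeet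
  rw [M.cover] at hyc
  obtain ⟨L, hL, hyL⟩ := Set.mem_iUnion₂.1 hyc
  rcases halfBall_subset_or_disjoint (M.isPolytopalCell L hL).isOpen (hflat L hL) with h | h
  · exact ⟨L, hL, h⟩
  · exact absurd hyL (Set.disjoint_left.1 h hy)

theorem Mesh.exists_cell_side (he : ‖e‖ = 1) (hR : 0 < R)
    (hflat : ∀ K ∈ M.cells, ∀ y ∈ frontier K, y ∈ Metric.ball x R → inner ℝ e (y - x) = 0)
    (hx : x ∈ ⋃ K ∈ M.cells, frontier K) :
    ∃ n : EuclideanSpace ℝ (Fin d), ‖n‖ = 1 ∧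
      (∀ K ∈ M.cells, ∀ y ∈ frontier K, y ∈ Metric.ball x R → inner ℝ n (y - x) = 0) ∧
      ∃ K ∈ M.cells, halfBall x (-n) R ⊆ K ∧ Disjoint (halfBall x n R) (closure K) := by
  obtain ⟨K, hK, hxK⟩ := Set.mem_iUnion₂.1 hx
  obtain ⟨n, hn, h1, h2⟩ := exists_side (M.isPolytopalCell K hK).isOpen
    (M.isPolytopalCell K hK).interior_closure hxK he hR (hflat K hK)
  refine ⟨n, ?_, fun L hL y hy hyb => ?_, K, hK, h1, h2⟩
  · rcases hn with rfl | rfl <;> simp [he]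
  · rcases hn with rfl | rfl <;> simp [inner_neg_left, hflat L hL y hy hyb]

/-- At a flat point of the skeleton exactly two cells meet, one on each side. -/
theorem Mesh.exists_two_sides (hΩ : interior (closure Ω) = Ω) (he : ‖e‖ = 1) (hR : 0 < R)
    (hflat : ∀ K ∈ M.cells, ∀ y ∈ frontier K, y ∈ Metric.ball x R → inner ℝ e (y - x) = 0)
    (hx : x ∈ M.skeleton) :
    ∃ n : EuclideanSpace ℝ (Fin d), ‖n‖ = 1 ∧ ∃ r > 0,
      (∀ K ∈ M.cells, ∀ y ∈ frontier K, y ∈ Metric.ball x r → inner ℝ n (y - x) = 0) ∧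
      Metric.ball x r ⊆ Ω ∧ ∃ K ∈ M.cells, ∃ L ∈ M.cells,
        (∀ y ∈ Metric.ball x r, (y ∈ K ↔ inner ℝ n (y - x) < 0)) ∧
        (∀ y ∈ Metric.ball x r, (y ∈ L ↔ inner ℝ (-n) (y - x) < 0)) ∧
        ∀ Q ∈ M.cells, Q ≠ K → Q ≠ L → Disjoint Q (Metric.ball x r) := by
  obtain ⟨s, hs, hsΩ⟩ := Metric.isOpen_iff.1 (isOpen_of_interior_closure_eq hΩ) x hx.1
  have hr : 0 < min R s := lt_min hR hs
  obtain ⟨n, hn, hfl, K, hK, hneg, hpos⟩ := M.exists_cell_side he hr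
    (fun K hK y hy hyb => hflat K hK y hy (Metric.ball_subset_ball (min_le_left _ _) hyb)) hx.2
  have hbΩ : Metric.ball x (min R s) ⊆ Ω :=
    (Metric.ball_subset_ball (min_le_right _ _)).trans hsΩ
  -- The half ball opposite to `K` lies in `Ω`, so the closure of some cell meets it, and that cell
  -- fills it.
  obtain ⟨z, -, hz⟩ := exists_mem_halfBall (x := x) (y := x) (R := min R s) isOpen_univ hn
    (Set.mem_univ x) (Metric.mem_ball_self hr) (by simp)
  obtain ⟨L, hL, hLsub⟩ := M.exists_halfBall_subset hfl
    (Set.not_disjoint_iff.2 ⟨z, hz, subset_closure (hbΩ hz.1)⟩)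
  have hKL : K ≠ L := by
    rintro rfl
    exact Set.disjoint_left.1 hpos hz (subset_closure (hLsub hz))
  have hdisj := M.disjoint
  refine ⟨n, hn, _, hr, hfl, hbΩ, K, hK, L, hL,
    mem_iff_of_halfBall (M.isPolytopalCell K hK).isOpen hn hneg (hpos.mono_right subset_closure),
    mem_iff_of_halfBall (M.isPolytopalCell L hL).isOpen (by rwa [norm_neg]) (by rwa [neg_neg])
      ((hdisj K hK L hL hKL).mono_left hneg), fun Q hQ hQK hQL => ?_⟩
  exact disjoint_ball_of_halfBall (M.isPolytopalCell Q hQ).isOpen hn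
    ((hdisj K hK Q hQ hQK.symm).mono_left hneg) ((hdisj L hL Q hQ hQL.symm).mono_left hLsub)

/-- At a flat point of the boundary exactly one cell lies on the inner side. -/
theorem Mesh.exists_inner_side (hΩ : interior (closure Ω) = Ω) (he : ‖e‖ = 1) (hR : 0 < R)
    (hflat : ∀ K ∈ M.cells, ∀ y ∈ frontier K, y ∈ Metric.ball x R → inner ℝ e (y - x) = 0)
    (hx : x ∈ frontier Ω) :
    ∃ n : EuclideanSpace ℝ (Fin d), ‖n‖ = 1 ∧
      (∀ K ∈ M.cells, ∀ y ∈ frontier K, y ∈ Metric.ball x R → inner ℝ n (y - x) = 0) ∧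
      ∃ K ∈ M.cells, (∀ y ∈ Metric.ball x R, (y ∈ K ↔ inner ℝ n (y - x) < 0)) ∧
        ∀ y ∈ Metric.ball x R, (y ∈ Ω ↔ inner ℝ n (y - x) < 0) := by
  have hΩo := isOpen_of_interior_closure_eq hΩ
  have hxΩ : x ∉ Ω := fun h => hx.2 (by rwa [hΩo.interior_eq])
  obtain ⟨n, hn, hfl, K, hK, hneg, hpos⟩ := M.exists_cell_side he hR hflat
    (M.frontier_subset hΩ hx)
  have hKΩ := M.cell_subset hΩ hK
  refine ⟨n, hn, hfl, K, hK, mem_iff_of_halfBall (M.isPolytopalCell K hK).isOpen hn hneg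
    (hpos.mono_right subset_closure), mem_iff_of_halfBall hΩo hn (hneg.trans hKΩ) ?_⟩
  -- If `Ω` reached the outer half ball, a cell would fill it; then `x` would be interior to
  -- `closure Ω`, hence in `Ω`.
  by_contra hmeet
  obtain ⟨L, hL, hLsub⟩ := M.exists_halfBall_subset hfl
    fun h => hmeet (h.mono_right subset_closure)
  refine hxΩ ?_
  rw [← hΩ, mem_interior]
  refine ⟨Metric.ball x R, fun y hy => mem_closure_iff.2 fun O hO hyO => ?_,
    Metric.isOpen_ball, Metric.mem_ball_self hR⟩
  rcases le_total 0 (inner ℝ n (y - x)) with h | h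
  · obtain ⟨z, hzO, hz⟩ := exists_mem_halfBall hO hn hyO hy h
    exact ⟨z, hzO, M.cell_subset hΩ hL (hLsub hz)⟩
  · obtain ⟨z, hzO, hz⟩ := exists_mem_halfBall hO (e := -n) (by rwa [norm_neg]) hyO hy
      (by rw [inner_neg_left]; linarith)
    exact ⟨z, hzO, hKΩ (hneg hz)⟩

theorem outwardNormal_eq {n : EuclideanSpace ℝ (Fin d)} (h : IsOutwardNormal Ω x n) :
    outwardNormal Ω x = n := by
  have hex : ∃ n, IsOutwardNormal Ω x n := ⟨n, h⟩
  rw [outwardNormal, dif_pos hex]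
  exact hex.choose_spec.unique h

/-- The chosen normal belongs to some cell, and a cell with a normal at `x` meets every ball around
`x`, which leaves only `K` and `L`. -/
theorem Mesh.skeletonNormal_eq_or {n : EuclideanSpace ℝ (Fin d)}
    {K L : Set (EuclideanSpace ℝ (Fin d))} (hK : K ∈ M.cells) (hKn : IsOutwardNormal K x n)
    (hLn : IsOutwardNormal L x (-n)) (hR : 0 < R)
    (hQ : ∀ Q ∈ M.cells, Q ≠ K → Q ≠ L → Disjoint Q (Metric.ball x R)) :
    M.skeletonNormal x = n ∨ M.skeletonNormal x = -n := by
  have hex : ∃ n, ∃ K ∈ M.cells, IsOutwardNormal K x n := ⟨n, K, hK, hKn⟩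
  rw [skeletonNormal, dif_pos hex]
  obtain ⟨Q, hQc, hQn⟩ := hex.choose_spec
  by_cases h1 : Q = K
  · subst h1
    exact Or.inl (hQn.unique hKn)
  by_cases h2 : Q = L
  · subst h2
    exact Or.inr (hQn.unique hLn)
  obtain ⟨z, hz, hzQ⟩ := hQn.exists_mem_ball hR
  exact absurd hz (Set.disjoint_left.1 (hQ Q hQc h1 h2) hzQ)

end LocalStructure

/-! ### Bumps cut off to one cell -/

section TestFunctions

variable {d : ℕ} {φ : EuclideanSpace ℝ (Fin d) → ℝ}

theorem memH1_of_contDiff (hφ : ContDiff ℝ ∞ φ) (hc : HasCompactSupport φ)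
    (K : Set (EuclideanSpace ℝ (Fin d))) : MemH1 K φ := by
  have hφ' : ∀ v, Continuous fun x => fderiv ℝ φ x v := fun v =>
    (hφ.continuous_fderiv (by simp)).clm_apply continuous_const
  refine ⟨(hφ.continuous.memLp_of_hasCompactSupport hc).restrict K,
    fun x => WithLp.toLp 2 fun i => fderiv ℝ φ x (EuclideanSpace.single i 1), ?_, ?_⟩
  · refine (Continuous.memLp_of_hasCompactSupport ?_ ?_).restrict K
    · exact (PiLp.continuous_toLp 2 _).comp (continuous_pi fun i => hφ' _)
    · refine (hc.fderiv ℝ).mono fun x hx h0 => hx ?_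
      ext i
      simp [h0]
  · intro ψ hψ hψc hψK i
    have hψ' : Continuous fun x => fderiv ℝ ψ x (EuclideanSpace.single i 1) :=
      (hψ.continuous_fderiv (by simp)).clm_apply continuous_const
    have hz : ∀ x ∉ K, ψ x = 0 := fun x hx => image_eq_zero_of_notMem_tsupport fun h => hx (hψK h)
    have hz' : ∀ x ∉ K, fderiv ℝ ψ x = 0 := fun x hx =>
      image_eq_zero_of_notMem_tsupport fun h => hx (hψK (tsupport_fderiv_subset ℝ h))
    rw [setIntegral_eq_integral_of_forall_compl_eq_zero fun x hx => by simp [hz' x hx],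
      setIntegral_eq_integral_of_forall_compl_eq_zero fun x hx => by simp [hz x hx]]
    refine integral_mul_fderiv_eq_neg_fderiv_mul_of_integrable ?_ ?_ ?_
      (fun x _ => hφ.differentiable (by simp) x) (fun x _ => hψ.differentiable (by simp) x)
    · exact ((hφ' _).mul hψ.continuous).integrable_of_hasCompactSupport hψc.mul_left
    · exact (hφ.continuous.mul hψ').integrable_of_hasCompactSupport hc.mul_right
    · exact (hφ.continuous.mul hψ.continuous).integrable_of_hasCompactSupport hc.mul_right

theorem MemH1.congr {K : Set (EuclideanSpace ℝ (Fin d))} {v w : EuclideanSpace ℝ (Fin d) → ℝ}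
    (hw : MemH1 K w) (hK : MeasurableSet K) (h : ∀ x ∈ K, v x = w x) : MemH1 K v := by
  obtain ⟨h2, G, hG2, hG⟩ := hw
  refine ⟨h2.ae_eq ?_, G, hG2, fun ψ h1 h2 h3 i => ?_⟩
  · exact (ae_restrict_iff' hK).2 (Eventually.of_forall fun x hx => (h x hx).symm)
  · rw [← hG ψ h1 h2 h3 i]
    exact setIntegral_congr_fun hK fun x hx => by simp only [h x hx]

variable {Ω K : Set (EuclideanSpace ℝ (Fin d))} (M : Mesh Ω)

/-- Regularity in the broken space is tested cell by cell, and on each cell the function is either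
`φ` or zero. -/
theorem Mesh.indicator_mem_space (hK : K ∈ M.cells) (hφ : ContDiff ℝ ∞ φ)
    (hc : HasCompactSupport φ) : K.indicator φ ∈ M.space := by
  have hm : ∀ L ∈ M.cells, MeasurableSet L := fun L hL =>
    (M.isPolytopalCell L hL).isOpen.measurableSet
  refine ⟨((hφ.continuous.memLp_of_hasCompactSupport hc).restrict Ω).indicator (hm K hK),
    fun L hL => ?_⟩
  by_cases h : L = K
  · subst h
    exact (memH1_of_contDiff hφ hc L).congr (hm L hL) fun x hx => Set.indicator_of_mem hx _
  · have h0 : MemH1 L (0 : EuclideanSpace ℝ (Fin d) → ℝ) :=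
      memH1_of_contDiff contDiff_const HasCompactSupport.zero L
    exact h0.congr (hm L hL) fun x hx => Set.indicator_of_notMem
      (Set.disjoint_left.1 (M.disjoint L hL K hK h) hx) _

theorem tendsto_add_smul_essZeroRight (y m : EuclideanSpace ℝ (Fin d)) :
    Tendsto (fun ε : ℝ => y + ε • m) essZeroRight (𝓝 y) := by
  have h : Continuous fun ε : ℝ => y + ε • m := by fun_prop
  have h0 : Tendsto (fun ε : ℝ => y + ε • m) (𝓝 0) (𝓝 y) := by simpa using h.tendsto 0
  exact (h0.mono_left nhdsWithin_le_nhds).mono_left inf_le_left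

theorem tendsto_indicator_of_notMem_tsupport {y : EuclideanSpace ℝ (Fin d)} (hy : y ∉ tsupport φ)
    (m : EuclideanSpace ℝ (Fin d)) :
    Tendsto (fun ε : ℝ => K.indicator φ (y + ε • m)) essZeroRight (𝓝 0) := by
  refine tendsto_const_nhds.congr' ?_
  filter_upwards [(tendsto_add_smul_essZeroRight y m).eventually
    (notMem_tsupport_iff_eventuallyEq.1 hy)] with ε hε
  by_cases h : y + ε • m ∈ K <;> simp [h, hε]

theorem IsOutwardNormal.tendsto_indicator_inside {y n : EuclideanSpace ℝ (Fin d)}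
    (h : IsOutwardNormal K y n) (hφ : Continuous φ) :
    Tendsto (fun ε : ℝ => K.indicator φ (y - ε • n)) essZeroRight (𝓝 (φ y)) := by
  obtain ⟨hn, r, hr, hK⟩ := h
  have hlim := tendsto_add_smul_essZeroRight y (-n)
  simp only [smul_neg, ← sub_eq_add_neg] at hlim
  refine ((hφ.tendsto y).comp hlim).congr' ?_
  filter_upwards [hlim.eventually (Metric.ball_mem_nhds y hr),
    eventually_essZeroRight one_pos (p := fun ε => 0 < ε) (Eventually.of_forall fun ε h _ => h)]
    with ε h1 h0
  refine (Set.indicator_of_mem ((hK _ h1).2 ?_) φ).symm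
  rw [sub_sub_cancel_left, inner_neg_right, inner_smul_right, real_inner_self_eq_norm_sq, hn]
  linarith

theorem IsOutwardNormal.tendsto_indicator_outside {y n : EuclideanSpace ℝ (Fin d)}
    (h : IsOutwardNormal K y n) :
    Tendsto (fun ε : ℝ => K.indicator φ (y + ε • n)) essZeroRight (𝓝 0) := by
  obtain ⟨hn, r, hr, hK⟩ := h
  have hlim := tendsto_add_smul_essZeroRight y n
  refine tendsto_const_nhds.congr' ?_
  filter_upwards [hlim.eventually (Metric.ball_mem_nhds y hr),
    eventually_essZeroRight one_pos (p := fun ε => 0 < ε) (Eventually.of_forall fun ε h _ => h)]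
    with ε h1 h0
  refine (Set.indicator_of_notMem (fun hm => ?_) φ).symm
  have := (hK _ h1).1 hm
  rw [add_sub_cancel_left, inner_smul_right, real_inner_self_eq_norm_sq, hn] at this
  linarith

end TestFunctions

/-! ### From local to global almost-everywhere statements -/

section Localization

variable {d : ℕ}

/-- In a second countable space a locally null set is null, so the radius may depend on the point
without uniformity. -/
theorem ae_restrict_of_local {μ : Measure (EuclideanSpace ℝ (Fin d))}
    {s N : Set (EuclideanSpace ℝ (Fin d))} {P : EuclideanSpace ℝ (Fin d) → Prop}
    (hs : MeasurableSet s) (hN : μ N = 0)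
    (h : ∀ x ∈ s, x ∉ N → ∃ r > 0, ∀ᵐ y ∂μ.restrict s, y ∈ Metric.ball x r → P y) :
    ∀ᵐ y ∂μ.restrict s, P y := by
  rw [ae_restrict_iff' hs]
  have h0 : μ {y | y ∈ s ∧ y ∉ N ∧ ¬ P y} = 0 := by
    refine measure_null_of_locally_null _ fun x hx => ?_
    obtain ⟨r, hr, hP⟩ := h x hx.1 hx.2.1
    rw [ae_restrict_iff' hs] at hP
    refine ⟨_, inter_mem_nhdsWithin _ (Metric.ball_mem_nhds x hr), measure_mono_null ?_ hP⟩
    exact fun y hy hPy => hy.1.2.2 (hPy hy.1.1 hy.2)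
  refine measure_mono_null (fun y hy => ?_) (measure_union_null h0 hN)
  by_cases hyN : y ∈ N
  · exact Or.inr hyN
  · refine Or.inl ⟨?_, hyN, ?_⟩
    · by_contra hys
      exact hy fun h => absurd h hys
    · exact fun hPy => hy fun _ => hPy

theorem surfaceMeasure_hyperplane_inter_ball_lt_top {x n : EuclideanSpace ℝ (Fin d)}
    (hn : ‖n‖ = 1) (r : ℝ) :
    surfaceMeasure d ({y | inner ℝ n (y - x) = 0} ∩ Metric.ball x r) < ⊤ := by
  rw [Set.inter_comm, ← Measure.restrict_apply measurableSet_ball, ← map_volume_hyperplane x hn,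
    (measurableEmbedding_hyperplane x n).map_apply]
  refine ((Metric.isBounded_ball (x := (0 : (ℝ ∙ n)ᗮ)) (r := r)).subset
    fun y hy => ?_).measure_lt_top
  simpa using hy

variable {K : Set (EuclideanSpace ℝ (Fin d))} {w : EuclideanSpace ℝ (Fin d) → ℝ}
  {x n : EuclideanSpace ℝ (Fin d)} {R : ℝ}

theorem MemH1.exists_outward_trace (hK : IsPolytopalCell K) (hw : MemH1 K w)
    (hn : ‖n‖ = 1) (hR : 0 < R)
    (hmem : ∀ y ∈ Metric.ball x R, (y ∈ K ↔ inner ℝ n (y - x) < 0)) :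
    ∃ c : EuclideanSpace ℝ (Fin d) → ℝ,
      IntegrableOn c {y | inner ℝ n (y - x) = 0} (surfaceMeasure d) ∧
      ∀ᵐ y ∂surfaceMeasure d, inner ℝ n (y - x) = 0 → y ∈ Metric.ball x (R / 2) →
        Tendsto (fun ε : ℝ => w (y - ε • n)) essZeroRight (𝓝 (c y)) := by
  obtain ⟨c, hc1, hc2⟩ := hw.exists_trace (x₀ := x) (e := -n) hK.isOpen hK.isBounded
    (by rwa [norm_neg]) hR fun y hy h => (hmem y hy).2 (by rw [inner_neg_left] at h; linarith)
  simp only [inner_neg_left, neg_eq_zero, smul_neg, ← sub_eq_add_neg] at hc1 hc2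
  have hm : MeasurableSet {y | inner ℝ n (y - x) = 0} :=
    (isClosed_eq (by fun_prop) continuous_const).measurableSet
  exact ⟨c, hc1, (ae_restrict_iff' hm).1 hc2⟩

end Localization

/-! ### Recovering jump and trace conditions from `Dw = b` -/

section Converse

variable {d : ℕ} {Ω : Set (EuclideanSpace ℝ (Fin d))} (M : Mesh Ω)
  {ΓD : Set (EuclideanSpace ℝ (Fin d))} {ubar w : EuclideanSpace ℝ (Fin d) → ℝ}
  {x e : EuclideanSpace ℝ (Fin d)} {R : ℝ}

theorem Mesh.measurableSet_skeleton (hΩ : interior (closure Ω) = Ω) :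
    MeasurableSet M.skeleton :=
  (isOpen_of_interior_closure_eq hΩ).measurableSet.inter
    (M.cells.measurableSet_biUnion fun _ _ => isClosed_frontier.measurableSet)

theorem Mesh.jump_indicator_of_notMem_tsupport {K : Set (EuclideanSpace ℝ (Fin d))}
    {φ : EuclideanSpace ℝ (Fin d) → ℝ} {y : EuclideanSpace ℝ (Fin d)} (hy : y ∉ tsupport φ) :
    M.jump (K.indicator φ) y = 0 := by
  refine Tendsto.limUnder_eq ?_
  have h1 := tendsto_indicator_of_notMem_tsupport (K := K) hy (M.skeletonNormal y)
  have h2 := tendsto_indicator_of_notMem_tsupport (K := K) hy (-M.skeletonNormal y)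
  unfold Mesh.normalDifference
  simpa [sub_eq_add_neg] using h1.sub h2

theorem boundaryTrace_indicator_of_notMem_tsupport {K : Set (EuclideanSpace ℝ (Fin d))}
    {φ : EuclideanSpace ℝ (Fin d) → ℝ} {y : EuclideanSpace ℝ (Fin d)} (hy : y ∉ tsupport φ) :
    boundaryTrace Ω (K.indicator φ) y = 0 := by
  refine Tendsto.limUnder_eq ?_
  simpa [sub_eq_add_neg] using
    tendsto_indicator_of_notMem_tsupport (K := K) hy (-outwardNormal Ω y)

/-- Testing with `L.indicator φ`, whose support avoids `ΓD`, gives `∫ (b - a) φ = 0` over the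
skeleton, where `a` and `b` are the traces of `w` from `K` and `L`. -/
theorem Mesh.ae_tendsto_normalDifference (hΩ : interior (closure Ω) = Ω) (hΓD : ΓD ⊆ frontier Ω)
    (hw : w ∈ M.space)
    (hD : ∀ v ∈ M.space, M.constraintForm ΓD w v
      = ∫ y in ΓD, ubar y * boundaryTrace Ω v y ∂surfaceMeasure d)
    (he : ‖e‖ = 1) (hR : 0 < R)
    (hflat : ∀ K ∈ M.cells, ∀ y ∈ frontier K, y ∈ Metric.ball x R → inner ℝ e (y - x) = 0)
    (hx : x ∈ M.skeleton) :
    ∃ r > 0, ∀ᵐ y ∂(surfaceMeasure d).restrict M.skeleton, y ∈ Metric.ball x r →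
      Tendsto (M.normalDifference w y) essZeroRight (𝓝 0) := by
  obtain ⟨n, hn, R, hR, hfl, hbΩ, K, hK, L, hL, hKn, hLn, hQ⟩ :=
    M.exists_two_sides hΩ he hR hflat hx
  have hn' : ‖-n‖ = 1 := by rwa [norm_neg]
  obtain ⟨a, hai, ha⟩ := (hw.2 K hK).exists_outward_trace (M.isPolytopalCell K hK) hn hR hKn
  obtain ⟨b, hbi, hb⟩ := (hw.2 L hL).exists_outward_trace (M.isPolytopalCell L hL) hn' hR hLn
  simp only [inner_neg_left, neg_eq_zero, smul_neg, sub_neg_eq_add] at hbi hb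
  have hr : 0 < R / 2 := by positivity
  have hsub : Metric.ball x (R / 2) ⊆ Metric.ball x R := Metric.ball_subset_ball (by linarith)
  have hskm := M.measurableSet_skeleton hΩ
  have hplane : ∀ y ∈ M.skeleton, y ∈ Metric.ball x R → inner ℝ n (y - x) = 0 := by
    intro y hy hyb
    obtain ⟨Q, hQc, hyQ⟩ := Set.mem_iUnion₂.1 hy.2
    exact hfl Q hQc y hyQ hyb
  have hout : ∀ y ∈ M.skeleton, y ∈ Metric.ball x R →
      IsOutwardNormal K y n ∧ IsOutwardNormal L y (-n) ∧
        (M.skeletonNormal y = n ∨ M.skeletonNormal y = -n) := by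
    intro y hy hyb
    have h0 := hplane y hy hyb
    have h1 := isOutwardNormal_of_mem_iff hn hKn hyb h0
    have h2 := isOutwardNormal_of_mem_iff hn' hLn hyb (by rw [inner_neg_left, h0, neg_zero])
    obtain ⟨s, hs, hsb⟩ := Metric.isOpen_iff.1 Metric.isOpen_ball y hyb
    exact ⟨h1, h2, M.skeletonNormal_eq_or hK h1 h2 hs fun Q hQc hQK hQL =>
      (hQ Q hQc hQK hQL).mono_right hsb⟩
  -- The chosen normal may flip from point to point without any measurability; both jumps flip with
  -- it, so their product does not.
  have hcases : ∀ y ∈ M.skeleton, y ∈ Metric.ball x R →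
      ∀ (v : EuclideanSpace ℝ (Fin d) → ℝ) (α β : ℝ),
      Tendsto (fun ε : ℝ => v (y - ε • n)) essZeroRight (𝓝 α) →
      Tendsto (fun ε : ℝ => v (y + ε • n)) essZeroRight (𝓝 β) →
      (M.skeletonNormal y = n → Tendsto (M.normalDifference v y) essZeroRight (𝓝 (β - α))) ∧
      (M.skeletonNormal y = -n → Tendsto (M.normalDifference v y) essZeroRight (𝓝 (α - β))) := by
    intro y hy hyb v α β hα hβ
    unfold Mesh.normalDifference
    refine ⟨fun h => ?_, fun h => ?_⟩
    · have := hβ.sub hα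
      simpa only [h] using this
    · have := hα.sub hβ
      simpa only [h, smul_neg, sub_neg_eq_add, ← sub_eq_add_neg] using this
  have hlim : ∀ᵐ y ∂(surfaceMeasure d).restrict M.skeleton, y ∈ Metric.ball x (R / 2) →
      Tendsto (fun ε : ℝ => w (y - ε • n)) essZeroRight (𝓝 (a y)) ∧
      Tendsto (fun ε : ℝ => w (y + ε • n)) essZeroRight (𝓝 (b y)) := by
    rw [ae_restrict_iff' hskm]
    filter_upwards [ha, hb] with y hya hyb hy hyr
    have h0 := hplane y hy (hsub hyr)
    exact ⟨hya h0 hyr, hyb h0 hyr⟩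
  have hint : IntegrableOn (fun y => b y - a y) (Metric.ball x (R / 2))
      ((surfaceMeasure d).restrict M.skeleton) := by
    rw [IntegrableOn, Measure.restrict_restrict measurableSet_ball]
    exact (hbi.sub hai).mono_set fun y hy => hplane y hy.2 (hsub hy.1)
  have hzero := Metric.isOpen_ball.ae_eq_zero_of_integral_contDiff_smul_eq_zero
    hint.locallyIntegrableOn fun φ hφ hc hs => ?_
  · refine ⟨R / 2, hr, ?_⟩
    filter_upwards [hzero, hlim, ae_restrict_mem hskm] with y h0 h1 hy hyr
    have hab := hcases y hy (hsub hyr) w _ _ (h1 hyr).1 (h1 hyr).2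
    have h0' := h0 hyr
    rcases (hout y hy (hsub hyr)).2.2 with h | h
    · simpa only [h0'] using hab.1 h
    · have := hab.2 h
      rwa [← neg_sub, h0', neg_zero] at this
  have hv := M.indicator_mem_space hL hφ hc
  have hns : ∀ y ∈ ΓD, y ∉ tsupport φ := by
    intro y hy hyt
    have hyΩ := hbΩ (hsub (hs hyt))
    refine (hΓD hy).2 ?_
    rwa [(isOpen_of_interior_closure_eq hΩ).interior_eq]
  have hform := hD _ hv
  have hz : ∀ f : EuclideanSpace ℝ (Fin d) → ℝ,
      ∫ y in ΓD, f y * boundaryTrace Ω (L.indicator φ) y ∂surfaceMeasure d = 0 := by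
    intro f
    refine setIntegral_eq_zero_of_forall_eq_zero fun y hy => ?_
    rw [boundaryTrace_indicator_of_notMem_tsupport (hns y hy), mul_zero]
  rw [Mesh.constraintForm, hz, hz, add_zero] at hform
  rw [← hform]
  refine integral_congr_ae ?_
  filter_upwards [hlim, ae_restrict_mem hskm] with y h1 hy
  by_cases hyt : y ∈ tsupport φ
  · have hyr := hs hyt
    obtain ⟨h1a, h1b⟩ := h1 hyr
    obtain ⟨-, hLy, hor⟩ := hout y hy (hsub hyr)
    have hva := hLy.tendsto_indicator_outside (φ := φ)
    have hvb := hLy.tendsto_indicator_inside hφ.continuous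
    simp only [smul_neg, sub_neg_eq_add, ← sub_eq_add_neg] at hva hvb
    have hjw := hcases y hy (hsub hyr) w _ _ h1a h1b
    have hjv := hcases y hy (hsub hyr) _ _ _ hva hvb
    rcases hor with h | h
    · rw [Mesh.jump, Mesh.jump, (hjw.1 h).limUnder_eq, (hjv.1 h).limUnder_eq, smul_eq_mul]
      ring
    · rw [Mesh.jump, Mesh.jump, (hjw.2 h).limUnder_eq, (hjv.2 h).limUnder_eq, smul_eq_mul]
      ring
  · rw [M.jump_indicator_of_notMem_tsupport hyt, image_eq_zero_of_notMem_tsupport hyt, zero_smul,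
      mul_zero]

/-- Testing with `K.indicator φ`, `K` the only cell at the flat boundary piece, gives `∫ (a - ubar)
φ = 0` over `ΓD`, where `a` is the trace of `w`. -/
theorem Mesh.ae_tendsto_boundary (hΩ : interior (closure Ω) = Ω) (hΓD : ΓD ⊆ frontier Ω)
    (hΓDm : MeasurableSet ΓD) (hubar : MemLp ubar 2 ((surfaceMeasure d).restrict ΓD))
    (hw : w ∈ M.space)
    (hD : ∀ v ∈ M.space, M.constraintForm ΓD w v
      = ∫ y in ΓD, ubar y * boundaryTrace Ω v y ∂surfaceMeasure d)
    (he : ‖e‖ = 1) (hR : 0 < R)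
    (hflat : ∀ K ∈ M.cells, ∀ y ∈ frontier K, y ∈ Metric.ball x R → inner ℝ e (y - x) = 0)
    (hx : x ∈ ΓD) :
    ∃ r > 0, ∀ᵐ y ∂(surfaceMeasure d).restrict ΓD, y ∈ Metric.ball x r →
      Tendsto (fun ε : ℝ => w (y - ε • outwardNormal Ω y)) essZeroRight (𝓝 (ubar y)) := by
  obtain ⟨n, hn, hfl, K, hK, hKn, hΩn⟩ := M.exists_inner_side hΩ he hR hflat (hΓD hx)
  obtain ⟨a, hai, ha⟩ := (hw.2 K hK).exists_outward_trace (M.isPolytopalCell K hK) hn hR hKn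
  have hr : 0 < R / 2 := by positivity
  have hsub : Metric.ball x (R / 2) ⊆ Metric.ball x R := Metric.ball_subset_ball (by linarith)
  have hplane : ∀ y ∈ ΓD, y ∈ Metric.ball x R → inner ℝ n (y - x) = 0 := by
    intro y hy hyb
    obtain ⟨Q, hQc, hyQ⟩ := Set.mem_iUnion₂.1 (M.frontier_subset hΩ (hΓD hy))
    exact hfl Q hQc y hyQ hyb
  have hout : ∀ y ∈ ΓD, y ∈ Metric.ball x R →
      IsOutwardNormal K y n ∧ outwardNormal Ω y = n := by
    intro y hy hyb
    have h0 := hplane y hy hyb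
    exact ⟨isOutwardNormal_of_mem_iff hn hKn hyb h0,
      outwardNormal_eq (isOutwardNormal_of_mem_iff hn hΩn hyb h0)⟩
  have hlim : ∀ᵐ y ∂(surfaceMeasure d).restrict ΓD, y ∈ Metric.ball x (R / 2) →
      Tendsto (fun ε : ℝ => w (y - ε • outwardNormal Ω y)) essZeroRight (𝓝 (a y)) := by
    rw [ae_restrict_iff' hΓDm]
    filter_upwards [ha] with y hya hy hyr
    rw [(hout y hy (hsub hyr)).2]
    exact hya (hplane y hy (hsub hyr)) hyr
  have hai' : IntegrableOn a (Metric.ball x (R / 2)) ((surfaceMeasure d).restrict ΓD) := by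
    rw [IntegrableOn, Measure.restrict_restrict measurableSet_ball]
    exact hai.mono_set fun y hy => hplane y hy.2 (hsub hy.1)
  have hui : IntegrableOn ubar (Metric.ball x (R / 2)) ((surfaceMeasure d).restrict ΓD) := by
    have hfin : IsFiniteMeasure
        (((surfaceMeasure d).restrict ΓD).restrict (Metric.ball x (R / 2))) := by
      refine ⟨?_⟩
      rw [Measure.restrict_apply_univ, Measure.restrict_apply measurableSet_ball]
      have hle : Metric.ball x (R / 2) ∩ ΓD ⊆
          {y | inner ℝ n (y - x) = 0} ∩ Metric.ball x (R / 2) :=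
        fun y hy => ⟨hplane y hy.2 (hsub hy.1), hy.1⟩
      exact (measure_mono hle).trans_lt
        (surfaceMeasure_hyperplane_inter_ball_lt_top hn (R / 2))
    exact (hubar.restrict _).integrable (by norm_num)
  have hzero := Metric.isOpen_ball.ae_eq_zero_of_integral_contDiff_smul_eq_zero
    (hai'.sub hui).locallyIntegrableOn fun φ hφ hc hs => ?_
  · refine ⟨R / 2, hr, ?_⟩
    filter_upwards [hzero, hlim] with y h0 h1 hyr
    rw [← sub_eq_zero.1 (h0 hyr)]
    exact h1 hyr
  have hv := M.indicator_mem_space hK hφ hc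
  have hform := hD _ hv
  -- The skeleton misses the ball: its points there would lie on the hyperplane, whereas `Ω` is the
  -- open half strictly below it.
  have hz : ∫ y in M.skeleton, M.jump w y * M.jump (K.indicator φ) y ∂surfaceMeasure d = 0 := by
    refine setIntegral_eq_zero_of_forall_eq_zero fun y hy => ?_
    rw [M.jump_indicator_of_notMem_tsupport, mul_zero]
    intro hyt
    have hyb := hsub (hs hyt)
    obtain ⟨Q, hQc, hyQ⟩ := Set.mem_iUnion₂.1 hy.2
    have h1 := (hΩn y hyb).1 hy.1
    rw [hfl Q hQc y hyQ hyb] at h1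
    exact lt_irrefl _ h1
  have htr : ∀ y ∈ ΓD, boundaryTrace Ω (K.indicator φ) y = φ y := by
    intro y hy
    by_cases hyt : y ∈ tsupport φ
    · obtain ⟨h1, h2⟩ := hout y hy (hsub (hs hyt))
      refine Tendsto.limUnder_eq ?_
      rw [h2]
      exact h1.tendsto_indicator_inside hφ.continuous
    · rw [boundaryTrace_indicator_of_notMem_tsupport hyt, image_eq_zero_of_notMem_tsupport hyt]
  obtain ⟨A, hA⟩ := hc.exists_bound_of_continuous hφ.continuous
  -- The two integrals can be subtracted only if both are genuine, since the integral of a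
  -- non-integrable function is zero by convention.
  have hbdd : ∀ f : EuclideanSpace ℝ (Fin d) → ℝ,
      IntegrableOn f (Metric.ball x (R / 2)) ((surfaceMeasure d).restrict ΓD) →
      Integrable (fun y => f y * φ y) ((surfaceMeasure d).restrict ΓD) := by
    intro f hf
    refine (integrableOn_iff_integrable_of_support_subset
      (s := Metric.ball x (R / 2)) fun y hy => hs (subset_tsupport φ fun h0 => hy ?_)).1
      (hf.mul_bdd hφ.continuous.aestronglyMeasurable (Eventually.of_forall hA))
    simp [h0]
  rw [Mesh.constraintForm, hz, zero_add] at hform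
  have h1 : ∫ y in ΓD, boundaryTrace Ω w y * boundaryTrace Ω (K.indicator φ) y ∂surfaceMeasure d
      = ∫ y in ΓD, a y * φ y ∂surfaceMeasure d := by
    refine integral_congr_ae ?_
    filter_upwards [hlim, ae_restrict_mem hΓDm] with y h1 hy
    rw [htr y hy]
    by_cases hyt : y ∈ tsupport φ
    · rw [boundaryTrace, (h1 (hs hyt)).limUnder_eq]
    · rw [image_eq_zero_of_notMem_tsupport hyt, mul_zero, mul_zero]
  have h2 : ∫ y in ΓD, ubar y * boundaryTrace Ω (K.indicator φ) y ∂surfaceMeasure d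
      = ∫ y in ΓD, ubar y * φ y ∂surfaceMeasure d :=
    setIntegral_congr_fun hΓDm fun y hy => by simp only [htr y hy]
  rw [h1, h2, ← sub_eq_zero, ← integral_sub (hbdd a hai') (hbdd ubar hui)] at hform
  rw [← hform]
  refine integral_congr_ae (Eventually.of_forall fun y => ?_)
  simp only [Pi.sub_apply, smul_eq_mul]
  ring

end Converse

end BrokenSobolev

/-! ### The equivalence -/

theorem mainTheorem3 {d : ℕ} (hd : 1 ≤ d) (Ω : Set (EuclideanSpace ℝ (Fin d)))
    (hΩ : interior (closure Ω) = Ω) (M : BrokenSobolev.Mesh Ω)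
    (ΓD : Set (EuclideanSpace ℝ (Fin d))) (hΓD : ΓD ⊆ frontier Ω) (hΓDm : MeasurableSet ΓD)
    (ubar : EuclideanSpace ℝ (Fin d) → ℝ)
    (hubar : MemLp ubar 2 ((BrokenSobolev.surfaceMeasure d).restrict ΓD))
    (w : M.space) :
    (w : EuclideanSpace ℝ (Fin d) → ℝ) ∈ M.admissible ΓD ubar ↔
      M.constraintOperator ΓD w = M.dirichletFunctional ΓD ubar := by
  constructor
  · rintro ⟨-, hjump, htrace⟩
    funext v
    have h1 : ∫ x in M.skeleton, M.jump w x * M.jump v x ∂BrokenSobolev.surfaceMeasure d = 0 := by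
      refine integral_eq_zero_of_ae ?_
      filter_upwards [hjump] with x hx
      rw [BrokenSobolev.Mesh.jump, hx.limUnder_eq, zero_mul, Pi.zero_apply]
    rw [BrokenSobolev.Mesh.constraintOperator, BrokenSobolev.Mesh.constraintForm, h1, zero_add]
    refine integral_congr_ae ?_
    filter_upwards [htrace] with x hx
    rw [BrokenSobolev.boundaryTrace, hx.limUnder_eq]
  · intro h
    have hD : ∀ v ∈ M.space, M.constraintForm ΓD w v = ∫ y in ΓD,
        ubar y * BrokenSobolev.boundaryTrace Ω v y ∂BrokenSobolev.surfaceMeasure d :=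
      fun v hv => congrFun h ⟨v, hv⟩
    obtain ⟨N, hN, hflat⟩ := BrokenSobolev.exists_null_forall_flat M.isPolytopalCell
    refine ⟨w.2, BrokenSobolev.ae_restrict_of_local (M.measurableSet_skeleton hΩ) hN
      fun x hx hxN => ?_, BrokenSobolev.ae_restrict_of_local hΓDm hN fun x hx hxN => ?_⟩
    · obtain ⟨e, he, R, hR, hfl⟩ := hflat x hx.2 hxN
      exact M.ae_tendsto_normalDifference hΩ hΓD w.2 hD he hR hfl hx
    · obtain ⟨e, he, R, hR, hfl⟩ := hflat x (M.frontier_subset hΩ (hΓD hx)) hxN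
      exact M.ae_tendsto_boundary hΩ hΓD hΓDm hubar w.2 hD he hR hfl hx
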